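/- Let $(N,g,J)$ be a $6$-dimensional strict nearly Kähler manifold: $N$ is a smooth $6$-manifold with a smooth Riemannian metric $g$ with Levi-Civita connection $\tilde\nabla$, and a smooth almost complex structure $J$ ($J^2=-\mathrm{id}$) with $g(JX,JY)=g(X,Y)$, such that $(\tilde\nabla_XJ)X=0$ for every tangent vector $X$, and $\tilde\nabla_XJ\neq 0$ for every non-zero tangent vector $X$. Let $M$ be a Lagrangian submanifold of $N$, that is, a smooth $3$-manifold $M$ with a smooth immersion $f:M\to N$ such that at every $p\in M$ the endomorphism $J$ interchanges the tangent space $df(T_pM)$ and the normal space $df(T_pM)^{\perp}$. Let $h$ be the second fundamental form of $f$, i.e. $h(X,Y)$ is the normal part of $\tilde\nabla_X\,df(Y)$. Then $M$ is isotropic in the sense of O'Neill, that is, there is a function $\mu:M\to[0,\infty)$ such that $$g(h(v,v),h(v,v))=\mu(p)^2\,g(v,v)^2\qquad\text{for all } p\in M,\ v\in T_pM$$ (where $g(v,v)$ means $g(df(v),df(v))$), if and only if $M$ is totally geodesic, that is, $h=0$ identically. -/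

import Mathlib

open Bundle Manifold FiberBundle VectorField
open scoped ContDiff Topology

noncomputable section

namespace NearlyKahler

section LeviCivita

variable {E : Type*} [NormedAddCommGroup E] [NormedSpace ℝ E]
  {H : Type*} [TopologicalSpace H] {I : ModelWithCorners ℝ E H}
  {N : Type*} [TopologicalSpace N] [ChartedSpace H N] [IsManifold I ∞ N]
  (g : ContMDiffRiemannianMetric I ∞ E (fun x : N => TangentSpace I x))

/-- The function `y ↦ g(Y, Z)(y)` obtained from two vector fields. -/
def pairing (Y Z : Π x : N, TangentSpace I x) (y : N) : ℝ := g.inner y (Y y) (Z y)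

theorem pairing_comm (Y Z : Π x : N, TangentSpace I x) : pairing g Y Z = pairing g Z Y :=
  funext fun y => g.symm y _ _

theorem mdifferentiableAt_pairing {Y Z : Π x : N, TangentSpace I x} {x : N}
    (hY : MDiffAt (T% Y) x) (hZ : MDiffAt (T% Z) x) : MDiffAt (pairing g Y Z) x := by
  have hg := (g.contMDiff x).mdifferentiableAt (by simp)
  have : MDifferentiableAt I (I.prod 𝓘(ℝ))
      (fun m ↦ TotalSpace.mk' ℝ (E := Bundle.Trivial N ℝ) m (g.inner m (Y m) (Z m))) x :=
    MDifferentiableAt.clm_bundle_apply₂ (F₁ := E) (F₂ := E) hg hY hZ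
  simp only [mdifferentiableAt_totalSpace] at this
  exact this.2

theorem mvfderiv_pairing_smul {f : N → ℝ} {Y Z : Π x : N, TangentSpace I x} {x : N}
    (hf : MDiffAt f x) (hY : MDiffAt (T% Y) x) (hZ : MDiffAt (T% Z) x) :
    mvfderiv I (pairing g (f • Y) Z) x =
      f x • mvfderiv I (pairing g Y Z) x + pairing g Y Z x • mvfderiv I f x := by
  have h : pairing g (f • Y) Z = f * pairing g Y Z := by
    funext y
    simp [pairing]
  rw [h, mvfderiv_mul hf (mdifferentiableAt_pairing g hY hZ)]

theorem mvfderiv_pairing_add {Y Y' Z : Π x : N, TangentSpace I x} {x : N}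
    (hY : MDiffAt (T% Y) x) (hY' : MDiffAt (T% Y') x) (hZ : MDiffAt (T% Z) x) :
    mvfderiv I (pairing g (Y + Y') Z) x =
      mvfderiv I (pairing g Y Z) x + mvfderiv I (pairing g Y' Z) x := by
  have h : pairing g (Y + Y') Z = pairing g Y Z + pairing g Y' Z := by
    funext y
    simp [pairing]
  rw [h, mvfderiv_add (mdifferentiableAt_pairing g hY hZ) (mdifferentiableAt_pairing g hY' hZ)]

/-- The Koszul expression
`½ (X g(Y,Z) + Y g(Z,X) - Z g(X,Y) + g([X,Y],Z) - g([Y,Z],X) + g([Z,X],Y))` at the point `x`. -/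
def koszul (X Y Z : Π x : N, TangentSpace I x) (x : N) : ℝ :=
  (1 / 2 : ℝ) *
    (mvfderiv I (pairing g Y Z) x (X x)
      + mvfderiv I (pairing g Z X) x (Y x)
      - mvfderiv I (pairing g X Y) x (Z x)
      + g.inner x (mlieBracket I X Y x) (Z x)
      - g.inner x (mlieBracket I Y Z x) (X x)
      + g.inner x (mlieBracket I Z X x) (Y x))

variable [FiniteDimensional ℝ E]

theorem koszul_tensorial_left {Y Z : Π x : N, TangentSpace I x} {x : N}
    (hY : MDiffAt (T% Y) x) (hZ : MDiffAt (T% Z) x) :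
    TensorialAt I E (fun X => koszul g X Y Z x) x where
  smul {f X} hf hX := by
    simp only [koszul, mlieBracket_smul_left hf hX, mlieBracket_smul_right hf hX,
      pairing_comm g Z, mvfderiv_pairing_smul g hf hX hY, mvfderiv_pairing_smul g hf hX hZ]
    simp [pairing]
    ring
  add {X X'} hX hX' := by
    simp only [koszul, mlieBracket_add_left hX hX', mlieBracket_add_right hX hX',
      pairing_comm g Z, mvfderiv_pairing_add g hX hX' hY, mvfderiv_pairing_add g hX hX' hZ]
    simp
    ring

theorem koszul_tensorial_right {X Y : Π x : N, TangentSpace I x} {x : N}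
    (hX : MDiffAt (T% X) x) (hY : MDiffAt (T% Y) x) :
    TensorialAt I E (fun Z => koszul g X Y Z x) x where
  smul {f Z} hf hZ := by
    simp only [koszul, mlieBracket_smul_left hf hZ, mlieBracket_smul_right hf hZ,
      pairing_comm g Y, mvfderiv_pairing_smul g hf hZ hX, mvfderiv_pairing_smul g hf hZ hY]
    simp [pairing]
    ring
  add {Z Z'} hZ hZ' := by
    simp only [koszul, mlieBracket_add_left hZ hZ', mlieBracket_add_right hZ hZ',
      pairing_comm g Y, mvfderiv_pairing_add g hZ hZ' hX, mvfderiv_pairing_add g hZ hZ' hY]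
    simp
    ring

instance (x : N) : FiniteDimensional ℝ (TangentSpace I x) :=
  inferInstanceAs (FiniteDimensional ℝ E)

instance (x : N) : T2Space (TangentSpace I x) := inferInstanceAs (T2Space E)

/-- The musical isomorphism `v ↦ g(v, ·)` from the tangent space to its dual. -/
def flat (x : N) : TangentSpace I x ≃ₗ[ℝ] (TangentSpace I x →L[ℝ] ℝ) :=
  LinearEquiv.ofBijective (g.inner x).toLinearMap <| by
    have hinj : Function.Injective (g.inner x).toLinearMap := by
      rw [← LinearMap.ker_eq_bot, LinearMap.ker_eq_bot']
      intro v hv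
      by_contra h
      have h0 : g.inner x v v = 0 := congrArg (fun l : TangentSpace I x →L[ℝ] ℝ => l v) hv
      exact (g.pos x v h).ne' h0
    have hfin : Module.finrank ℝ (TangentSpace I x)
        = Module.finrank ℝ (TangentSpace I x →L[ℝ] ℝ) := by
      rw [← (LinearMap.toContinuousLinearMap
        (𝕜 := ℝ) (E := TangentSpace I x) (F' := ℝ)).finrank_eq]
      exact (Subspace.dual_finrank_eq (K := ℝ) (V := TangentSpace I x)).symm
    exact ⟨hinj, (LinearMap.injective_iff_surjective_of_finrank_eq_finrank hfin).1 hinj⟩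

@[simp] theorem inner_flat_symm (x : N) (l : TangentSpace I x →L[ℝ] ℝ) (w : TangentSpace I x) :
    g.inner x ((flat g x).symm l) w = l w :=
  congrArg (fun k : TangentSpace I x →L[ℝ] ℝ => k w) ((flat g x).apply_symm_apply l)

open Classical in
/-- The Levi-Civita derivative of a vector field `Y`: at each point `x` where `Y` is
differentiable, `∇_X Y` is the vector with `g(∇_X Y, Z) = koszul X Y Z`. -/
def leviCivitaFun (Y : Π x : N, TangentSpace I x) (x : N) :
    TangentSpace I x →L[ℝ] TangentSpace I x :=
  if hY : MDiffAt (T% Y) x then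
    LinearMap.toContinuousLinearMap ((flat g x).symm.toLinearMap ∘ₗ
      (TensorialAt.mkHom₂ (fun X Z => koszul g X Y Z x) x
        (fun _ hZ => koszul_tensorial_left g hY hZ)
        (fun _ hX => koszul_tensorial_right g hX hY)).toLinearMap)
  else 0

theorem inner_leviCivitaFun {X Y Z : Π x : N, TangentSpace I x} {x : N}
    (hX : MDiffAt (T% X) x) (hY : MDiffAt (T% Y) x) (hZ : MDiffAt (T% Z) x) :
    g.inner x (leviCivitaFun g Y x (X x)) (Z x) = koszul g X Y Z x := by
  simp only [leviCivitaFun, dif_pos hY]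
  exact (inner_flat_symm g x _ _).trans (TensorialAt.mkHom₂_apply
    (fun _ hZ => koszul_tensorial_left g hY hZ) (fun _ hX => koszul_tensorial_right g hX hY) hX hZ)

theorem eq_of_inner_eq {x : N} {u w : TangentSpace I x}
    (h : ∀ z : TangentSpace I x, g.inner x u z = g.inner x w z) : u = w :=
  (flat g x).injective (ContinuousLinearMap.ext h)

theorem koszul_add_middle {X Y Y' Z : Π x : N, TangentSpace I x} {x : N}
    (hX : MDiffAt (T% X) x) (hY : MDiffAt (T% Y) x) (hY' : MDiffAt (T% Y') x)
    (hZ : MDiffAt (T% Z) x) :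
    koszul g X (Y + Y') Z x = koszul g X Y Z x + koszul g X Y' Z x := by
  simp only [koszul, mlieBracket_add_left hY hY', mlieBracket_add_right hY hY',
    pairing_comm g X, mvfderiv_pairing_add g hY hY' hX, mvfderiv_pairing_add g hY hY' hZ]
  simp
  ring

theorem koszul_smul_middle {f : N → ℝ} {X Y Z : Π x : N, TangentSpace I x} {x : N}
    (hf : MDiffAt f x) (hX : MDiffAt (T% X) x) (hY : MDiffAt (T% Y) x) (hZ : MDiffAt (T% Z) x) :
    koszul g X (f • Y) Z x =
      f x * koszul g X Y Z x + mvfderiv I f x (X x) * g.inner x (Y x) (Z x) := by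
  simp only [koszul, mlieBracket_smul_left hf hY, mlieBracket_smul_right hf hY,
    pairing_comm g X, mvfderiv_pairing_smul g hf hY hX, mvfderiv_pairing_smul g hf hY hZ]
  simp [pairing]
  ring

/-- The Levi-Civita connection of the Riemannian metric `g`;
`leviCivita g Y x (X x)` is `(∇_X Y)(x)`. -/
def leviCivita : CovariantDerivative I E (fun x : N => TangentSpace I x) where
  toFun := leviCivitaFun g
  isCovariantDerivativeOnUniv := {
    add := by
      intro Y Y' x hY hY' _
      ext v
      refine eq_of_inner_eq g fun z => ?_
      have hv := mdifferentiableAt_extend I E v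
      have hz := mdifferentiableAt_extend I E z
      have h := inner_leviCivitaFun g hv (mdifferentiableAt_add_section hY hY') hz
      have h1 := inner_leviCivitaFun g hv hY hz
      have h2 := inner_leviCivitaFun g hv hY' hz
      simp only [extend_apply_self] at h h1 h2
      have e : g.inner x ((leviCivitaFun g Y x + leviCivitaFun g Y' x) v) z =
          g.inner x (leviCivitaFun g Y x v) z + g.inner x (leviCivitaFun g Y' x v) z := by
        simp
      rw [e, h1, h2]
      exact h.trans (koszul_add_middle g hv hY hY' hz)
    leibniz := by
      intro Y f x hY hf _
      ext v
      refine eq_of_inner_eq g fun z => ?_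
      have hv := mdifferentiableAt_extend I E v
      have hz := mdifferentiableAt_extend I E z
      have h := inner_leviCivitaFun g hv (hf.smul_section hY) hz
      have h1 := inner_leviCivitaFun g hv hY hz
      have h2 := koszul_smul_middle g hf hv hY hz
      simp only [extend_apply_self] at h h1 h2
      have e : g.inner x ((f x • leviCivitaFun g Y x
            + (mvfderiv I f x).smulRight (Y x)) v) z =
          f x * g.inner x (leviCivitaFun g Y x v) z
            + mvfderiv I f x v * g.inner x (Y x) z := by
        simp
      rw [e, h1]
      exact h.trans h2 }

/-- The Levi-Civita connection is metric. -/
theorem leviCivita_metric {X Y Z : Π x : N, TangentSpace I x} {x : N}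
    (hX : MDiffAt (T% X) x) (hY : MDiffAt (T% Y) x) (hZ : MDiffAt (T% Z) x) :
    mvfderiv I (fun y => g.inner y (Y y) (Z y)) x (X x) =
      g.inner x (leviCivita g Y x (X x)) (Z x) + g.inner x (Y x) (leviCivita g Z x (X x)) := by
  have h1 := inner_leviCivitaFun g hX hY hZ
  have h2 := inner_leviCivitaFun g hX hZ hY
  rw [g.symm x (Y x)]
  change mvfderiv I (pairing g Y Z) x (X x) =
    g.inner x (leviCivitaFun g Y x (X x)) (Z x) + g.inner x (leviCivitaFun g Z x (X x)) (Y x)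
  rw [h1, h2, koszul, koszul, pairing_comm g Z Y, pairing_comm g Y X, pairing_comm g Z X,
    mlieBracket_swap_apply (V := Y) (W := X), mlieBracket_swap_apply (V := Z) (W := Y),
    mlieBracket_swap_apply (V := Z) (W := X)]
  simp
  ring

/-- The Levi-Civita connection is torsion-free. -/
theorem leviCivita_torsion {X Y : Π x : N, TangentSpace I x} {x : N}
    (hX : MDiffAt (T% X) x) (hY : MDiffAt (T% Y) x) :
    leviCivita g Y x (X x) - leviCivita g X x (Y x) = mlieBracket I X Y x := by
  refine eq_of_inner_eq g fun z => ?_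
  have hz := mdifferentiableAt_extend I E z
  have h1 := inner_leviCivitaFun g hX hY hz
  have h2 := inner_leviCivitaFun g hY hX hz
  rw [map_sub]
  change g.inner x (leviCivitaFun g Y x (X x)) z - g.inner x (leviCivitaFun g X x (Y x)) z = _
  rw [koszul] at h1 h2
  rw [pairing_comm g X, pairing_comm g Y X, mlieBracket_swap_apply (V := Y) (W := X),
    mlieBracket_swap_apply (V := X) (W := extend E z),
    mlieBracket_swap_apply (V := extend E z) (W := Y), pairing_comm g _ Y] at h2
  simp only [extend_apply_self] at h1 h2
  rw [h1, h2]
  simp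
  ring

end LeviCivita

section NormalSpace

variable {E : Type*} [NormedAddCommGroup E] [NormedSpace ℝ E]
  {H : Type*} [TopologicalSpace H] {I : ModelWithCorners ℝ E H}
  {N : Type*} [TopologicalSpace N] [ChartedSpace H N] [IsManifold I ∞ N]
  (g : ContMDiffRiemannianMetric I ∞ E (fun x : N => TangentSpace I x))

/-- The orthogonal complement of a subspace of a tangent space with respect to `g`. -/
def normalSpace {x : N} (S : Submodule ℝ (TangentSpace I x)) :
    Submodule ℝ (TangentSpace I x) where
  carrier := {n | ∀ s ∈ S, g.inner x n s = 0}
  add_mem' := by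
    intro a b ha hb s hs
    simp [ha s hs, hb s hs]
  zero_mem' := by
    intro s _
    simp
  smul_mem' := by
    intro c a ha s hs
    simp [ha s hs]

variable [FiniteDimensional ℝ E]

theorem isCompl_normalSpace {x : N} (S : Submodule ℝ (TangentSpace I x)) :
    IsCompl (normalSpace g S) S := by
  let B : LinearMap.BilinForm ℝ (TangentSpace I x) :=
    (ContinuousLinearMap.coeLM ℝ).comp (g.inner x).toLinearMap
  have hB : ∀ u w, B u w = g.inner x u w := fun _ _ => rfl
  have hrefl : B.IsRefl := fun u w h => by rw [hB, g.symm, ← hB, h]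
  have horth : B.orthogonal S = normalSpace g S := by
    ext n
    rw [LinearMap.BilinForm.mem_orthogonal_iff]
    refine forall₂_congr fun s _ => ?_
    rw [g.symm]
    exact Iff.rfl
  rw [← horth]
  refine ((LinearMap.BilinForm.isCompl_orthogonal_iff_disjoint hrefl).2 ?_).symm
  rw [Submodule.disjoint_def]
  intro u hu hu'
  by_contra h
  exact (g.pos x u h).ne' (LinearMap.BilinForm.mem_orthogonal_iff.1 hu' u hu)

/-- The `g`-orthogonal projection of a tangent space onto the orthogonal complement of `S`. -/
def normalPart {x : N} (S : Submodule ℝ (TangentSpace I x)) :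
    TangentSpace I x →ₗ[ℝ] TangentSpace I x :=
  (normalSpace g S).projection S (isCompl_normalSpace g S)

end NormalSpace

section AlmostHermitian

variable {E : Type*} [NormedAddCommGroup E] [NormedSpace ℝ E] [FiniteDimensional ℝ E]
  {H : Type*} [TopologicalSpace H] {I : ModelWithCorners ℝ E H}
  {N : Type*} [TopologicalSpace N] [ChartedSpace H N] [IsManifold I ∞ N]
  (g : ContMDiffRiemannianMetric I ∞ E (fun x : N => TangentSpace I x))
  (J : Π x : N, TangentSpace I x →L[ℝ] TangentSpace I x)

/-- `J` is a smooth almost complex structure compatible with the metric `g`. -/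
structure IsAlmostHermitian : Prop where
  smooth : ContMDiff I (I.prod 𝓘(ℝ, E →L[ℝ] E)) ∞
    (fun x => TotalSpace.mk' (E →L[ℝ] E)
      (E := fun x : N => TangentSpace I x →L[ℝ] TangentSpace I x) x (J x))
  sq : ∀ (x : N) (v : TangentSpace I x), J x (J x v) = -v
  isometry : ∀ (x : N) (v w : TangentSpace I x), g.inner x (J x v) (J x w) = g.inner x v w

/-- `(∇J)Y`, i.e. `X ↦ (∇_X J)Y = ∇_X(JY) - J ∇_X Y`, for a vector field `Y`. -/
def covDerivJ (Y : Π x : N, TangentSpace I x) (x : N) : TangentSpace I x →L[ℝ] TangentSpace I x :=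
  leviCivita g (fun y => J y (Y y)) x - (J x).comp (leviCivita g Y x)

/-- Nearly Kähler: almost Hermitian with `(∇_Y J)Y = 0` for all vector fields `Y`. -/
structure IsNearlyKahler : Prop extends IsAlmostHermitian g J where
  skew : ∀ (x : N) (Y : Π x : N, TangentSpace I x), MDiffAt (T% Y) x →
    covDerivJ g J Y x (Y x) = 0

/-- Strict nearly Kähler: nearly Kähler, and `∇_v J ≠ 0` for every nonzero tangent vector `v`. -/
structure IsStrictNearlyKahler : Prop extends IsNearlyKahler g J where
  strict : ∀ (x : N) (v : TangentSpace I x), v ≠ 0 →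
    ∃ Y : Π x : N, TangentSpace I x, MDiffAt (T% Y) x ∧ covDerivJ g J Y x v ≠ 0

end AlmostHermitian

section Submanifold

variable {E' : Type*} [NormedAddCommGroup E'] [NormedSpace ℝ E']
  {H' : Type*} [TopologicalSpace H'] {I' : ModelWithCorners ℝ E' H'}
  {M : Type*} [TopologicalSpace M] [ChartedSpace H' M] [IsManifold I' ∞ M]
  {E : Type*} [NormedAddCommGroup E] [NormedSpace ℝ E] [FiniteDimensional ℝ E]
  {H : Type*} [TopologicalSpace H] {I : ModelWithCorners ℝ E H}
  {N : Type*} [TopologicalSpace N] [ChartedSpace H N] [IsManifold I ∞ N]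
  (g : ContMDiffRiemannianMetric I ∞ E (fun x : N => TangentSpace I x))
  (J : Π x : N, TangentSpace I x →L[ℝ] TangentSpace I x)
  (f : M → N)

/-- The derivative along `f : M → N` of a section `s` of `f^*TN`, for the pullback of the
Levi-Civita connection: writing `s = ∑ sⁱ (eᵢ ∘ f)` in the local frame `eᵢ` of `TN` around `f p`
given by the trivialization at `f p`, it is `v ↦ ∑ v(sⁱ) eᵢ + ∑ sⁱ(p) ∇_{df(v)} eᵢ`.
The field `extend E (s p)` is `∑ sⁱ(p) eᵢ`. -/
def derivAlong (s : Π p : M, TangentSpace I (f p)) (p : M) :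
    TangentSpace I' p →L[ℝ] TangentSpace I (f p) :=
  ((trivializationAt E (TangentSpace I : N → Type _) (f p)).symmL ℝ (f p)).comp
      (mvfderiv I' (fun q => (trivializationAt E (TangentSpace I : N → Type _) (f p)
        ⟨f q, s q⟩).2) p)
    + (leviCivita g (extend E (s p)) (f p)).comp (mfderiv I' I f p)

variable (I' I) in
/-- The image `df(T_p M)` of the tangent space at `p`, a subspace of `T_{f p} N`. -/
def tangentImage (p : M) : Submodule ℝ (TangentSpace I (f p)) :=
  LinearMap.range (mfderiv I' I f p).toLinearMap

variable (I') in
/-- The second fundamental form `h(v, w)` of the immersion `f` at `p`: the normal part of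
`∇_v (df W)`, where `W` is a vector field on `M` with `W p = w`. -/
def secondFundamentalForm (p : M) (v w : TangentSpace I' p) : TangentSpace I (f p) :=
  normalPart g (tangentImage I' I f p)
    (derivAlong g f (fun q => mfderiv I' I f q (extend E' w q)) p v)

variable (I') in
/-- A Lagrangian immersion: a smooth immersion such that `J` interchanges the tangent and the
normal spaces. -/
structure IsLagrangianImmersion : Prop where
  smooth : ContMDiff I' I ∞ f
  injective : ∀ p : M, Function.Injective (mfderiv I' I f p)
  map_tangent : ∀ p : M, (tangentImage I' I f p).map (J (f p)).toLinearMap =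
    normalSpace g (tangentImage I' I f p)
  map_normal : ∀ p : M, (normalSpace g (tangentImage I' I f p)).map (J (f p)).toLinearMap =
    tangentImage I' I f p

variable (I') in
/-- Isotropic in the sense of O'Neill: `g(h(v,v), h(v,v)) = μ(p)² g(v,v)²` for all `v ∈ T_p M`,
with a non-negative function `μ` on `M`; here `g(v,v)` is the induced metric. -/
def IsIsotropic : Prop :=
  ∃ μ : M → ℝ, (∀ p, 0 ≤ μ p) ∧ ∀ (p : M) (v : TangentSpace I' p),
    g.inner (f p) (secondFundamentalForm I' g f p v v) (secondFundamentalForm I' g f p v v) =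
      μ p ^ 2 * g.inner (f p) (mfderiv I' I f p v) (mfderiv I' I f p v) ^ 2

variable (I') in
/-- Totally geodesic: the second fundamental form vanishes identically. -/
def IsTotallyGeodesic : Prop :=
  ∀ (p : M) (v w : TangentSpace I' p), secondFundamentalForm I' g f p v w = 0

end Submanifold

end NearlyKahler

end

/-! The claim is pointwise once a few identities have been differentiated, so everything is computed
in charts. Write σ(u,v,w) = g((∇_u J)v, w), which is totally skew, and C(a,b,c) = g(J h(a,b), c) for
tangent vectors of M. In the code h is replaced by the full Hessian D²f + Γ(df, df): its tangential
part is killed by J followed by pairing with a tangent vector.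

Symmetry of C: differentiating g(J df a, df b) = 0 gives σ(d,a,b) + C(d,a,b) - C(d,b,a) = 0. The
cyclic sum leaves 3σ = 0 on tangent vectors (`covJ_eq_zero`), so C is totally symmetric
(`hessian_totally_symm`).

Minimality (`trace_hessian_eq_zero`): differentiating σ(e₀,e₁,e₂) = 0 along e_i produces a ∇²J term
and three terms containing h. Gray's formula (`covCovJ_pairing`) kills the former; the others add up
to the i-th trace of C times τ = σ(Je₀,e₁,e₂), and strictness in dimension six makes τ nonzero.
Gray's formula comes from the Ricci identity for J, which gives R(w,u,Jw,Ju) - R(w,u,w,u) = |(∇_w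
J)u|², and the resulting J-invariance of R.

Algebra (`eq_zero_of_isotropic_coefficients`): C is now a trace-free symmetric cubic form in three
variables with |C(v,v,·)|² = m|v|⁴. Comparing the norms of two symmetric 3×3 matrices built from C
forces m = 0, hence C = 0 by polarization. Since h is normal and J maps the tangent space onto the
normal space, h = 0. The converse takes μ = 0. -/

noncomputable section

namespace NearlyKahler

/-! ### Covariant calculus of a nearly Kähler structure in coordinates. -/

section LocalCalculus

set_option maxSynthPendingDepth 3

variable {E : Type*} [NormedAddCommGroup E] [NormedSpace ℝ E]

/-- `(∇_u J) v = D_u J v + Γ(u, J v) - J Γ(u, v)` in coordinates. -/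
def localCovJ (J : E → E →L[ℝ] E) (Γ : E → E →L[ℝ] E →L[ℝ] E) (y : E) : E →L[ℝ] E →L[ℝ] E :=
  fderiv ℝ J y + ((ContinuousLinearMap.compL ℝ E E E).flip (J y)).comp (Γ y)
    - (ContinuousLinearMap.compL ℝ E E E (J y)).comp (Γ y)

theorem localCovJ_apply (J : E → E →L[ℝ] E) (Γ : E → E →L[ℝ] E →L[ℝ] E) (y u v : E) :
    localCovJ J Γ y u v = fderiv ℝ J y u v + Γ y u (J y v) - J y (Γ y u v) := rfl

/-- The curvature `R(w, u) v` of the connection with Christoffel symbols `Γ`. -/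
def localCurvature (Γ : E → E →L[ℝ] E →L[ℝ] E) (y w u v : E) : E :=
  fderiv ℝ Γ y w u v - fderiv ℝ Γ y u w v + Γ y w (Γ y u v) - Γ y u (Γ y w v)

/-- The second covariant derivative `(∇²_{w,u} J) v` in coordinates. -/
def localCovCovJ (J : E → E →L[ℝ] E) (Γ : E → E →L[ℝ] E →L[ℝ] E) (y w u v : E) : E :=
  fderiv ℝ (localCovJ J Γ) y w u v + Γ y w (localCovJ J Γ y u v)
    - localCovJ J Γ y (Γ y w u) v - localCovJ J Γ y u (Γ y w v)

/-- Coordinate form of a nearly Kähler structure on an open set of a vector space: `G` is the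
metric, `J` the almost complex structure and `Γ` the Christoffel symbols of the Levi-Civita
connection. -/
structure IsLocalNearlyKahler (U : Set E) (G : E → E →L[ℝ] E →L[ℝ] ℝ) (J : E → E →L[ℝ] E)
    (Γ : E → E →L[ℝ] E →L[ℝ] E) : Prop where
  isOpen : IsOpen U
  contDiffOn_metric : ContDiffOn ℝ ∞ G U
  contDiffOn_complex : ContDiffOn ℝ ∞ J U
  contDiffOn_christoffel : ContDiffOn ℝ ∞ Γ U
  symm : ∀ y ∈ U, ∀ u v, G y u v = G y v u
  pos : ∀ y ∈ U, ∀ u, u ≠ 0 → 0 < G y u u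
  torsion : ∀ y ∈ U, ∀ u v, Γ y u v = Γ y v u
  metric : ∀ y ∈ U, ∀ w u v, fderiv ℝ G y w u v = G y (Γ y w u) v + G y u (Γ y w v)
  sq : ∀ y ∈ U, ∀ v, J y (J y v) = -v
  isometry : ∀ y ∈ U, ∀ u v, G y (J y u) (J y v) = G y u v
  skew : ∀ y ∈ U, ∀ v, localCovJ J Γ y v v = 0

/-- The device used throughout to differentiate an identity that holds on an open set: compute the
derivative by the product rule, then evaluate it to zero. -/
theorem HasFDerivAt.apply_eq_zero_of_eventually_eq {F : Type*} [NormedAddCommGroup F]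
    [NormedSpace ℝ F] {φ : E → F} {φ' : E →L[ℝ] F} {y : E} {c : F} (h : HasFDerivAt φ φ' y)
    (hc : ∀ᶠ z in 𝓝 y, φ z = c) (w : E) : φ' w = 0 := by
  have : HasFDerivAt φ (0 : E →L[ℝ] F) y := (hasFDerivAt_const c y).congr_of_eventuallyEq hc
  rw [h.unique this]; rfl

theorem hasFDerivAt_clm_apply_const {F F' : Type*} [NormedAddCommGroup F]
    [NormedSpace ℝ F] [NormedAddCommGroup F'] [NormedSpace ℝ F'] {φ : E → F →L[ℝ] F'}
    {φ' : E →L[ℝ] F →L[ℝ] F'} {y : E}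
    (h : HasFDerivAt φ φ' y) (v : F) : HasFDerivAt (fun z => φ z v) (φ'.flip v) y := by
  exact (ContinuousLinearMap.apply ℝ F' v).hasFDerivAt.comp y h

namespace IsLocalNearlyKahler

variable {U : Set E} {G : E → E →L[ℝ] E →L[ℝ] ℝ} {J : E → E →L[ℝ] E}
  {Γ : E → E →L[ℝ] E →L[ℝ] E} (h : IsLocalNearlyKahler U G J Γ) {y : E}

include h

theorem eventually_mem (hy : y ∈ U) : ∀ᶠ z in 𝓝 y, z ∈ U := h.isOpen.mem_nhds hy

theorem hasFDerivAt_metric (hy : y ∈ U) : HasFDerivAt G (fderiv ℝ G y) y :=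
  ((h.contDiffOn_metric.contDiffAt (h.isOpen.mem_nhds hy)).differentiableAt (by simp)).hasFDerivAt

theorem hasFDerivAt_complex (hy : y ∈ U) : HasFDerivAt J (fderiv ℝ J y) y :=
  ((h.contDiffOn_complex.contDiffAt (h.isOpen.mem_nhds hy)).differentiableAt (by simp)).hasFDerivAt

theorem hasFDerivAt_christoffel (hy : y ∈ U) : HasFDerivAt Γ (fderiv ℝ Γ y) y :=
  ((h.contDiffOn_christoffel.contDiffAt
    (h.isOpen.mem_nhds hy)).differentiableAt (by simp)).hasFDerivAt

theorem hasFDerivAt_fderiv_complex (hy : y ∈ U) :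
    HasFDerivAt (fderiv ℝ J) (fderiv ℝ (fderiv ℝ J) y) y :=
  (((h.contDiffOn_complex.contDiffAt (h.isOpen.mem_nhds hy)).fderiv_right (m := 1)
    (WithTop.coe_le_coe.2 (le_top : (2 : ℕ∞) ≤ ⊤))).differentiableAt (by simp)).hasFDerivAt

theorem differentiableAt_localCovJ (hy : y ∈ U) : DifferentiableAt ℝ (localCovJ J Γ) y := by
  have h1 := (h.hasFDerivAt_complex hy).differentiableAt
  have h2 := (h.hasFDerivAt_christoffel hy).differentiableAt
  have h3 := (h.hasFDerivAt_fderiv_complex hy).differentiableAt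
  have h4 : DifferentiableAt ℝ (fun y => (ContinuousLinearMap.compL ℝ E E E).flip (J y)) y :=
    ((ContinuousLinearMap.compL ℝ E E E).flip.differentiableAt).comp y h1
  have h5 : DifferentiableAt ℝ (fun y => (ContinuousLinearMap.compL ℝ E E E) (J y)) y :=
    ((ContinuousLinearMap.compL ℝ E E E).differentiableAt).comp y h1
  exact (h3.add (h4.clm_comp h2)).sub (h5.clm_comp h2)

theorem hasFDerivAt_localCovJ (hy : y ∈ U) :
    HasFDerivAt (localCovJ J Γ) (fderiv ℝ (localCovJ J Γ) y) y :=
  (h.differentiableAt_localCovJ hy).hasFDerivAt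

theorem fderiv_localCovJ_apply (hy : y ∈ U) (w u v : E) :
    fderiv ℝ (localCovJ J Γ) y w u v = fderiv ℝ (fderiv ℝ J) y w u v
      + fderiv ℝ Γ y w u (J y v) + Γ y u (fderiv ℝ J y w v)
      - fderiv ℝ J y w (Γ y u v) - J y (fderiv ℝ Γ y w u v) := by
  have h1 := h.hasFDerivAt_complex hy
  have h2 := hasFDerivAt_clm_apply_const (h.hasFDerivAt_christoffel hy) u
  have h3 := hasFDerivAt_clm_apply_const
    (hasFDerivAt_clm_apply_const (h.hasFDerivAt_fderiv_complex hy) u) v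
  have h4 := hasFDerivAt_clm_apply_const
    (hasFDerivAt_clm_apply_const (h.hasFDerivAt_localCovJ hy) u) v
  have h5 := (h3.add (h2.clm_apply (hasFDerivAt_clm_apply_const h1 v))).sub
    (h1.clm_apply (hasFDerivAt_clm_apply_const h2 v))
  have := congrArg (fun l : E →L[ℝ] E => l w) (h4.unique h5)
  simp at this
  rw [this]
  abel

theorem metric_complex_left (hy : y ∈ U) (u v : E) : G y (J y u) v = -G y u (J y v) := by
  rw [← h.isometry y hy, h.sq y hy]; simp

theorem localCovJ_swap (hy : y ∈ U) (u v : E) :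
    localCovJ J Γ y u v = -localCovJ J Γ y v u := by
  have := h.skew y hy (u + v)
  simp only [map_add, add_apply, h.skew y hy] at this
  rw [eq_neg_iff_add_eq_zero]
  simpa [add_comm] using this

/-- Differentiate J² = -1; the Christoffel terms cancel. -/
theorem localCovJ_complex (hy : y ∈ U) (u v : E) :
    localCovJ J Γ y u (J y v) = -J y (localCovJ J Γ y u v) := by
  have h1 := h.hasFDerivAt_complex hy
  have h2 := h1.clm_apply (hasFDerivAt_clm_apply_const h1 v)
  have h3 := HasFDerivAt.apply_eq_zero_of_eventually_eq (c := -v) h2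
    ((h.eventually_mem hy).mono fun z hz => h.sq z hz v) u
  simp only [localCovJ_apply, h.sq y hy, map_add, map_sub, map_neg]
  simp at h3
  rw [← sub_eq_zero, ← h3]
  abel

/-- J is skew for the metric and the connection is metric, so ∇_w J is skew too. With
`localCovJ_swap` this makes g((∇_w J)u, v) a 3-form. -/
theorem fderiv_complex_skew (hy : y ∈ U) (w u v : E) :
    G y (localCovJ J Γ y w u) v + G y u (localCovJ J Γ y w v) = 0 := by
  have h1 := h.hasFDerivAt_complex hy
  have hu := hasFDerivAt_clm_apply_const h1 u
  have hv := hasFDerivAt_clm_apply_const h1 v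
  have h2 := ((h.hasFDerivAt_metric hy).clm_apply hu).clm_apply (hasFDerivAt_const v y)
  have h3 := ((h.hasFDerivAt_metric hy).clm_apply (hasFDerivAt_const u y)).clm_apply hv
  have h4 := HasFDerivAt.apply_eq_zero_of_eventually_eq (c := 0) (h2.add h3)
    ((h.eventually_mem hy).mono fun z hz => by simp [h.metric_complex_left hz]) w
  simp [h.metric y hy, h.metric_complex_left hy] at h4
  simp only [localCovJ_apply, map_add, map_sub, add_apply, sub_apply, h.metric_complex_left hy]
  linarith

/-- `∇²_{w,u} J` is `g`-skew-adjoint. -/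
theorem localCovCovJ_skew (hy : y ∈ U) (w u v z : E) :
    G y (localCovCovJ J Γ y w u v) z + G y v (localCovCovJ J Γ y w u z) = 0 := by
  have h1 := hasFDerivAt_clm_apply_const (h.hasFDerivAt_localCovJ hy) u
  have hv := hasFDerivAt_clm_apply_const h1 v
  have hz := hasFDerivAt_clm_apply_const h1 z
  have h2 := ((h.hasFDerivAt_metric hy).clm_apply hv).clm_apply (hasFDerivAt_const z y)
  have h3 := ((h.hasFDerivAt_metric hy).clm_apply (hasFDerivAt_const v y)).clm_apply hz
  have h4 := HasFDerivAt.apply_eq_zero_of_eventually_eq (c := 0) (h2.add h3)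
    ((h.eventually_mem hy).mono fun t ht => h.fderiv_complex_skew ht u v z) w
  simp [h.metric y hy] at h4
  simp only [localCovCovJ, map_add, map_sub, add_apply, sub_apply]
  have h5 := h.fderiv_complex_skew hy (Γ y w u) v z
  have h6 := h.fderiv_complex_skew hy u (Γ y w v) z
  have h7 := h.fderiv_complex_skew hy u v (Γ y w z)
  linarith

theorem localCovCovJ_swap (hy : y ∈ U) (w u v : E) :
    localCovCovJ J Γ y w u v = -localCovCovJ J Γ y w v u := by
  have h1 := hasFDerivAt_clm_apply_const
    (hasFDerivAt_clm_apply_const (h.hasFDerivAt_localCovJ hy) u) v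
  have h2 := hasFDerivAt_clm_apply_const
    (hasFDerivAt_clm_apply_const (h.hasFDerivAt_localCovJ hy) v) u
  have h3 := HasFDerivAt.apply_eq_zero_of_eventually_eq (c := 0) (h1.add h2)
    ((h.eventually_mem hy).mono fun t ht => by simp [h.localCovJ_swap ht u v]) w
  simp at h3
  have h3' := eq_neg_of_add_eq_zero_left h3
  simp only [localCovCovJ, h3', h.localCovJ_swap hy v u, h.localCovJ_swap hy (Γ y w v) u,
    h.localCovJ_swap hy v (Γ y w u), map_neg]
  abel

/-- The covariant derivative of (∇_u J)J + J(∇_u J) = 0 in the direction w. -/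
theorem localCovCovJ_complex (hy : y ∈ U) (w u v : E) :
    localCovCovJ J Γ y w u (J y v) + J y (localCovCovJ J Γ y w u v) =
      -localCovJ J Γ y w (localCovJ J Γ y u v) - localCovJ J Γ y u (localCovJ J Γ y w v) := by
  have hJ := h.hasFDerivAt_complex hy
  have h1 := hasFDerivAt_clm_apply_const (h.hasFDerivAt_localCovJ hy) u
  have h2 := h1.clm_apply (hasFDerivAt_clm_apply_const hJ v)
  have h3 := hJ.clm_apply (hasFDerivAt_clm_apply_const h1 v)
  have h4 := HasFDerivAt.apply_eq_zero_of_eventually_eq (c := 0) (h2.add h3)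
    ((h.eventually_mem hy).mono fun t ht => by simp [h.localCovJ_complex ht u v]) w
  simp at h4
  have e2 : ∀ t, fderiv ℝ J y w t = localCovJ J Γ y w t - Γ y w (J y t) + J y (Γ y w t) := by
    intro t; rw [localCovJ_apply]; abel
  rw [e2 v, e2 (localCovJ J Γ y u v)] at h4
  simp only [localCovCovJ, map_add, map_sub, h.localCovJ_complex hy, map_neg] at h4 ⊢
  rw [← sub_eq_zero, ← h4]
  abel

/-- The Ricci identity for `J`. -/
theorem localCovCovJ_comm (hy : y ∈ U) (w u v : E) :
    localCovCovJ J Γ y w u v - localCovCovJ J Γ y u w v =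
      localCurvature Γ y w u (J y v) - J y (localCurvature Γ y w u v) := by
  have hs : fderiv ℝ (fderiv ℝ J) y w u = fderiv ℝ (fderiv ℝ J) y u w :=
    ((h.contDiffOn_complex.contDiffAt (h.isOpen.mem_nhds hy)).isSymmSndFDerivAt
      (by simpa using ENat.LEInfty.out)).eq w u
  simp only [localCovCovJ, localCurvature, h.fderiv_localCovJ_apply hy, localCovJ_apply, hs,
    h.torsion y hy w u, map_add, map_sub]
  abel

omit h in
theorem localCurvature_swap (w u v : E) :
    localCurvature Γ y w u v = -localCurvature Γ y u w v := by
  simp only [localCurvature]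
  abel

theorem fderiv_christoffel_symm (hy : y ∈ U) (w u v : E) :
    fderiv ℝ Γ y w u v = fderiv ℝ Γ y w v u := by
  have h1 := hasFDerivAt_clm_apply_const
    (hasFDerivAt_clm_apply_const (h.hasFDerivAt_christoffel hy) u) v
  have h2 := hasFDerivAt_clm_apply_const
    (hasFDerivAt_clm_apply_const (h.hasFDerivAt_christoffel hy) v) u
  have h3 := HasFDerivAt.apply_eq_zero_of_eventually_eq (c := 0) (h1.sub h2)
    ((h.eventually_mem hy).mono fun t ht => by simp [h.torsion t ht u v]) w
  simpa [sub_eq_zero] using h3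

/-- The first Bianchi identity. -/
theorem localCurvature_bianchi (hy : y ∈ U) (w u v : E) :
    localCurvature Γ y w u v + localCurvature Γ y u v w + localCurvature Γ y v w u = 0 := by
  simp only [localCurvature, h.fderiv_christoffel_symm hy v w u,
    h.fderiv_christoffel_symm hy w u v, h.fderiv_christoffel_symm hy u v w, h.torsion y hy v w,
    h.torsion y hy w u, h.torsion y hy u v]
  abel

theorem localCurvature_skew (hy : y ∈ U) (w u v : E) :
    G y (localCurvature Γ y w u v) v = 0 := by
  have hG2 : HasFDerivAt (fderiv ℝ G) (fderiv ℝ (fderiv ℝ G) y) y :=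
    (((h.contDiffOn_metric.contDiffAt (h.isOpen.mem_nhds hy)).fderiv_right (m := 1)
      (WithTop.coe_le_coe.2 (le_top : (2 : ℕ∞) ≤ ⊤))).differentiableAt (by simp)).hasFDerivAt
  have hs : fderiv ℝ (fderiv ℝ G) y w u = fderiv ℝ (fderiv ℝ G) y u w :=
    ((h.contDiffOn_metric.contDiffAt (h.isOpen.mem_nhds hy)).isSymmSndFDerivAt
      (by simpa using ENat.LEInfty.out)).eq w u
  -- Second derivatives of g(v,v) for a constant field v, from D_b g(v,v) = 2 g(Γ(b,v), v). Their
  -- symmetry in a and b is the skewness of the curvature.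
  have key : ∀ a b : E, fderiv ℝ (fderiv ℝ G) y a b v v =
      2 * (G y (fderiv ℝ Γ y a b v) v + G y (Γ y a (Γ y b v)) v + G y (Γ y b v) (Γ y a v)) := by
    intro a b
    have h1 := hasFDerivAt_clm_apply_const
      (hasFDerivAt_clm_apply_const (hasFDerivAt_clm_apply_const hG2 b) v) v
    have h2 := hasFDerivAt_clm_apply_const
      (hasFDerivAt_clm_apply_const (h.hasFDerivAt_christoffel hy) b) v
    have h3 := ((h.hasFDerivAt_metric hy).clm_apply h2).clm_apply (hasFDerivAt_const v y)
    have h4 := HasFDerivAt.apply_eq_zero_of_eventually_eq (c := 0) (h1.sub (h3.const_smul (2 : ℝ)))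
      ((h.eventually_mem hy).mono fun t ht => by
        simp [h.metric t ht, h.symm t ht v]
        ring) a
    simp [h.metric y hy] at h4
    linarith
  have h1 := key w u
  have h2 := key u w
  rw [hs] at h1
  simp only [localCurvature, map_add, map_sub, add_apply, sub_apply]
  rw [h.symm y hy (Γ y u v)] at h1
  linarith

end IsLocalNearlyKahler

end LocalCalculus

/-! ### Lagrangian maps in coordinates: vanishing of σ and symmetry of the cubic form C. -/

section LocalLagrangian

set_option maxSynthPendingDepth 3

variable {E : Type*} [NormedAddCommGroup E] [NormedSpace ℝ E]
  {E' : Type*} [NormedAddCommGroup E'] [NormedSpace ℝ E']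

/-- The coordinate expression `D²f(d, a) + Γ(df d, df a)` of `∇_d (df a)` along a map `f`. -/
def localHessian (Γ : E → E →L[ℝ] E →L[ℝ] E) (f : E' → E) (x d a : E') : E :=
  fderiv ℝ (fderiv ℝ f) x d a + Γ (f x) (fderiv ℝ f x d) (fderiv ℝ f x a)

/-- Coordinate form of a map whose tangent spaces are isotropic for the fundamental 2-form. -/
structure IsLocalIsotropicMap (V : Set E') (U : Set E) (G : E → E →L[ℝ] E →L[ℝ] ℝ)
    (J : E → E →L[ℝ] E) (f : E' → E) : Prop where
  isOpen : IsOpen V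
  contDiffOn : ContDiffOn ℝ ∞ f V
  mapsTo : Set.MapsTo f V U
  isotropic : ∀ x ∈ V, ∀ a b, G (f x) (J (f x) (fderiv ℝ f x a)) (fderiv ℝ f x b) = 0

namespace IsLocalIsotropicMap

variable {U : Set E} {G : E → E →L[ℝ] E →L[ℝ] ℝ} {J : E → E →L[ℝ] E}
  {Γ : E → E →L[ℝ] E →L[ℝ] E} {V : Set E'} {f : E' → E}
  (h : IsLocalNearlyKahler U G J Γ) (hf : IsLocalIsotropicMap V U G J f) {x : E'}

include hf

theorem eventually_mem (hx : x ∈ V) : ∀ᶠ z in 𝓝 x, z ∈ V := hf.isOpen.mem_nhds hx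

theorem hasFDerivAt (hx : x ∈ V) : HasFDerivAt f (fderiv ℝ f x) x :=
  ((hf.contDiffOn.contDiffAt (hf.isOpen.mem_nhds hx)).differentiableAt (by simp)).hasFDerivAt

theorem hasFDerivAt_fderiv (hx : x ∈ V) :
    HasFDerivAt (fderiv ℝ f) (fderiv ℝ (fderiv ℝ f) x) x :=
  (((hf.contDiffOn.contDiffAt (hf.isOpen.mem_nhds hx)).fderiv_right (m := 1)
    (WithTop.coe_le_coe.2 (le_top : (2 : ℕ∞) ≤ ⊤))).differentiableAt (by simp)).hasFDerivAt

include h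

theorem localHessian_symm (hx : x ∈ V) (d a : E') :
    localHessian Γ f x d a = localHessian Γ f x a d := by
  have hs : fderiv ℝ (fderiv ℝ f) x d a = fderiv ℝ (fderiv ℝ f) x a d :=
    ((hf.contDiffOn.contDiffAt (hf.isOpen.mem_nhds hx)).isSymmSndFDerivAt
      (by simpa using ENat.LEInfty.out)).eq d a
  rw [localHessian, localHessian, hs, h.torsion _ (hf.mapsTo hx)]

/-- The derivative along d of the isotropy condition for the constant fields a and b. -/
theorem covJ_add_hessian_sub_hessian (hx : x ∈ V) (d a b : E') :
    G (f x) (localCovJ J Γ (f x) (fderiv ℝ f x d) (fderiv ℝ f x a)) (fderiv ℝ f x b)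
      + G (f x) (J (f x) (localHessian Γ f x d a)) (fderiv ℝ f x b)
      - G (f x) (J (f x) (localHessian Γ f x d b)) (fderiv ℝ f x a) = 0 := by
  have hy := hf.mapsTo hx
  have hd := hf.hasFDerivAt hx
  have h1 := (h.hasFDerivAt_metric hy).comp x hd
  have h2 := (h.hasFDerivAt_complex hy).comp x hd
  have ha := hasFDerivAt_clm_apply_const (hf.hasFDerivAt_fderiv hx) a
  have hb := hasFDerivAt_clm_apply_const (hf.hasFDerivAt_fderiv hx) b
  have h3 := HasFDerivAt.apply_eq_zero_of_eventually_eq (c := 0)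
    ((h1.clm_apply (h2.clm_apply ha)).clm_apply hb)
    ((hf.eventually_mem hx).mono fun z hz => hf.isotropic z hz a b) d
  simp [h.metric _ hy, h.metric_complex_left hy] at h3
  simp only [localCovJ_apply, localHessian, map_add, map_sub, add_apply, sub_apply,
    h.metric_complex_left hy]
  have e : ∀ p, G (f x) (fderiv ℝ f x a) (J (f x) p) = -G (f x) p (J (f x) (fderiv ℝ f x a)) :=
    fun p => by rw [← h.metric_complex_left hy, h.symm _ hy]
  rw [e, e] at h3
  linarith

/-- The 3-form `g((∇_u J) v, w)` vanishes on Lagrangian subspaces tangent to a Lagrangian map. -/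
theorem covJ_eq_zero (hx : x ∈ V) (d a b : E') :
    G (f x) (localCovJ J Γ (f x) (fderiv ℝ f x d) (fderiv ℝ f x a)) (fderiv ℝ f x b) = 0 := by
  have hy := hf.mapsTo hx
  have h1 := hf.covJ_add_hessian_sub_hessian h hx d a b
  have h2 := hf.covJ_add_hessian_sub_hessian h hx a b d
  have h3 := hf.covJ_add_hessian_sub_hessian h hx b d a
  -- Cyclic invariance of σ. In the sum of `h1`, `h2` and `h3` the Hessian terms cancel in pairs
  -- because the Hessian is symmetric, leaving three equal copies of σ.
  have e : ∀ u v w, G (f x) (localCovJ J Γ (f x) v w) u = G (f x) (localCovJ J Γ (f x) u v) w := by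
    intro u v w
    have k1 := h.fderiv_complex_skew hy v w u
    have k2 := h.symm _ hy w (localCovJ J Γ (f x) v u)
    rw [h.localCovJ_swap hy v u] at k1 k2
    simp only [map_neg, neg_apply] at k1 k2
    linarith
  rw [hf.localHessian_symm h hx a d] at h2
  rw [hf.localHessian_symm h hx b d] at h3
  rw [e (fderiv ℝ f x d)] at h2
  rw [← e (fderiv ℝ f x b)] at h3
  rw [hf.localHessian_symm h hx b a] at h3
  linarith

theorem hessian_totally_symm (hx : x ∈ V) (d a b : E') :
    G (f x) (J (f x) (localHessian Γ f x d a)) (fderiv ℝ f x b) =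
      G (f x) (J (f x) (localHessian Γ f x d b)) (fderiv ℝ f x a) := by
  have h1 := hf.covJ_add_hessian_sub_hessian h hx d a b
  rw [hf.covJ_eq_zero h hx] at h1
  linarith

/-- The derivative along d of σ = 0, which holds on tangent vectors at every point of `V`. -/
theorem covCovJ_add_covJ_hessian (hx : x ∈ V) (d a b c : E') :
    G (f x) (localCovCovJ J Γ (f x) (fderiv ℝ f x d) (fderiv ℝ f x a) (fderiv ℝ f x b))
        (fderiv ℝ f x c)
      + G (f x) (localCovJ J Γ (f x) (localHessian Γ f x d a) (fderiv ℝ f x b)) (fderiv ℝ f x c)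
      + G (f x) (localCovJ J Γ (f x) (fderiv ℝ f x a) (localHessian Γ f x d b)) (fderiv ℝ f x c)
      + G (f x) (localCovJ J Γ (f x) (fderiv ℝ f x a) (fderiv ℝ f x b)) (localHessian Γ f x d c)
      = 0 := by
  have hy := hf.mapsTo hx
  have hd := hf.hasFDerivAt hx
  have h1 := (h.hasFDerivAt_metric hy).comp x hd
  have h2 := (h.hasFDerivAt_localCovJ hy).comp x hd
  have ha := hasFDerivAt_clm_apply_const (hf.hasFDerivAt_fderiv hx) a
  have hb := hasFDerivAt_clm_apply_const (hf.hasFDerivAt_fderiv hx) b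
  have hc := hasFDerivAt_clm_apply_const (hf.hasFDerivAt_fderiv hx) c
  have h3 := HasFDerivAt.apply_eq_zero_of_eventually_eq (c := 0)
    ((h1.clm_apply ((h2.clm_apply ha).clm_apply hb)).clm_apply hc)
    ((hf.eventually_mem hx).mono fun z hz => hf.covJ_eq_zero h hz a b c) d
  simp [h.metric _ hy] at h3
  simp only [localCovCovJ, localHessian, map_add, map_sub, add_apply, sub_apply]
  linarith

end IsLocalIsotropicMap

end LocalLagrangian

/-! ### Algebra of trace-free isotropic ternary cubics. -/

section IsotropicCubic

/-- A trace-free ternary cubic form (with coefficients `p, …, b`) whose gradient has constant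
length `m` on the unit sphere vanishes. -/
theorem eq_zero_of_isotropic_coefficients {p q r s t w y z a b m : ℝ}
    (t1 : p + s + w = 0) (t2 : q + y + a = 0) (t3 : r + z + b = 0)
    (iso : ∀ u v x : ℝ,
      (u ^ 2 * p + v ^ 2 * s + x ^ 2 * w + 2 * u * v * q + 2 * u * x * r + 2 * v * x * t) ^ 2
      + (u ^ 2 * q + v ^ 2 * y + x ^ 2 * a + 2 * u * v * s + 2 * u * x * t + 2 * v * x * z) ^ 2
      + (u ^ 2 * r + v ^ 2 * z + x ^ 2 * b + 2 * u * v * t + 2 * u * x * w + 2 * v * x * a) ^ 2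
      = m * (u ^ 2 + v ^ 2 + x ^ 2) ^ 2) : m = 0 := by
  -- The coefficients of the quartic identity, recovered from sample points. With h_ij the vector
  -- (C_ijk)_k they read |h_ii|² = m, ⟨h_ii, h_jj⟩ + 2|h_ij|² = m, ⟨h_ii, h_ij⟩ = 0 and ⟨h_ii, h_jk⟩
  -- + 2⟨h_ij, h_ik⟩ = 0, for distinct i, j, k.
  have x1 : p ^ 2 + q ^ 2 + r ^ 2 = m := by linarith [iso 1 0 0]
  have x2 : s ^ 2 + y ^ 2 + z ^ 2 = m := by linarith [iso 0 1 0]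
  have x3 : w ^ 2 + a ^ 2 + b ^ 2 = m := by linarith [iso 0 0 1]
  have x12 : p * s + q * y + r * z + 2 * (q ^ 2 + s ^ 2 + t ^ 2) = m := by
    linarith [iso 1 1 0, iso 1 (-1) 0]
  have x13 : p * w + q * a + r * b + 2 * (r ^ 2 + t ^ 2 + w ^ 2) = m := by
    linarith [iso 1 0 1, iso 1 0 (-1)]
  have x23 : s * w + y * a + z * b + 2 * (t ^ 2 + z ^ 2 + a ^ 2) = m := by
    linarith [iso 0 1 1, iso 0 1 (-1)]
  have x1112 : p * q + q * s + r * t = 0 := by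
    linarith [iso 1 1 0, iso 1 (-1) 0, iso 2 1 0, iso 2 (-1) 0]
  have x2221 : s * q + y * s + z * t = 0 := by
    linarith [iso 1 1 0, iso 1 (-1) 0, iso 2 1 0, iso 2 (-1) 0]
  have x1113 : p * r + q * t + r * w = 0 := by
    linarith [iso 1 0 1, iso 1 0 (-1), iso 2 0 1, iso 2 0 (-1)]
  have x3331 : w * r + a * t + b * w = 0 := by
    linarith [iso 1 0 1, iso 1 0 (-1), iso 2 0 1, iso 2 0 (-1)]
  have x2223 : s * t + y * z + z * a = 0 := by
    linarith [iso 0 1 1, iso 0 1 (-1), iso 0 2 1, iso 0 2 (-1)]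
  have x3332 : w * t + a * z + b * a = 0 := by
    linarith [iso 0 1 1, iso 0 1 (-1), iso 0 2 1, iso 0 2 (-1)]
  have x1123 : p * t + q * z + r * a + 2 * (q * r + s * t + t * w) = 0 := by
    linarith [iso 1 1 1, iso (-1) 1 1, iso 0 1 1]
  have x2213 : s * r + y * t + z * w + 2 * (q * t + s * z + t * a) = 0 := by
    linarith [iso 1 1 1, iso 1 (-1) 1, iso 1 0 1]
  have x3312 : w * q + a * s + b * t + 2 * (r * t + t * z + w * a) = 0 := by
    linarith [iso 1 1 1, iso 1 1 (-1), iso 1 1 0]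
  obtain rfl : w = -(p + s) := by linarith
  obtain rfl : a = -(q + y) := by linarith
  obtain rfl : b = -(r + z) := by linarith
  -- Let A_i be the matrix (C_ikl)_kl. Summing the polarized identities over k and using Σ h_kk = 0
  -- gives tr(A_i A_j) = (5/2) m δ_ij: the diagonal total is 3m + m + m = 5m, and it equals 2
  -- tr(A_i²).
  have T : p ^ 2 + s ^ 2 + (p + s) ^ 2 + 2 * (q ^ 2 + r ^ 2 + t ^ 2) = 5 / 2 * m := by linarith
  have T2 : q ^ 2 + y ^ 2 + (q + y) ^ 2 + 2 * (s ^ 2 + t ^ 2 + z ^ 2) = 5 / 2 * m := by linarith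
  have T3 : r ^ 2 + z ^ 2 + (r + z) ^ 2 + 2 * (t ^ 2 + (p + s) ^ 2 + (q + y) ^ 2) = 5 / 2 * m := by
    linarith
  have T12 : p * q + s * y + (p + s) * (q + y) + 2 * (q * s + r * t + t * z) = 0 := by linarith
  have T13 : p * r + s * z + (p + s) * (r + z) + 2 * (q * t - r * (p + s) - t * (q + y)) = 0 := by
    linarith
  have T23 : q * r + y * z + (q + y) * (r + z) + 2 * (s * t - t * (p + s) - z * (q + y)) = 0 := by
    linarith
  -- For X = h₀₀, with |X|² = m, the matrix A_X = pA₀ + qA₁ + rA₂ has squared norm (5/2) m². Its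
  -- entries are ⟨X, h_kl⟩, so its first row is (m, 0, 0).
  have hX : m ^ 2 + (p * s + q * y + r * z) ^ 2 + (p * (p + s) + q * (q + y) + r * (r + z)) ^ 2
      + 2 * (p * t + q * z - r * (q + y)) ^ 2 = 5 / 2 * m ^ 2 := by
    linear_combination p ^ 2 * T + q ^ 2 * T2 + r ^ 2 * T3 + 2 * p * q * T12 + 2 * p * r * T13
      + 2 * q * r * T23 + 5 / 2 * m * x1 - (p ^ 2 + q ^ 2 + r ^ 2 + m) * x1
      - 2 * (p * q + q * s + r * t) * x1112 - 2 * (p * r + q * t - r * (p + s)) * x1113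
  -- The squared norm of A₀², whose entries are ⟨h_0k, h_0l⟩: a trace-free symmetric 3×3 matrix
  -- satisfies tr A⁴ = ½ (tr A²)², here ½ (5m/2)².
  have hA : m ^ 2 + (q ^ 2 + s ^ 2 + t ^ 2) ^ 2 + (r ^ 2 + t ^ 2 + (p + s) ^ 2) ^ 2
      + 2 * (q * r + s * t - t * (p + s)) ^ 2 = 25 / 8 * m ^ 2 := by
    linear_combination (1 / 2) * (p ^ 2 + s ^ 2 + (p + s) ^ 2 + 2 * (q ^ 2 + r ^ 2 + t ^ 2)
      + 5 / 2 * m) * T - (p ^ 2 + q ^ 2 + r ^ 2 + m) * x1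
      - 2 * (p * q + q * s + r * t) * x1112 - 2 * (p * r + q * t - r * (p + s)) * x1113
  -- On the lower 2×2 block, A_X = m·1 - 2A₀². Since that block of A₀² has trace 5m/2 - m = 3m/2,
  -- the two norms are compatible only if 3m² = 0.
  have e1 : p * s + q * y + r * z = m - 2 * (q ^ 2 + s ^ 2 + t ^ 2) := by linarith
  have e2 : p * (p + s) + q * (q + y) + r * (r + z) = -(m - 2 * (r ^ 2 + t ^ 2 + (p + s) ^ 2)) := by
    linarith
  have e3 : p * t + q * z - r * (q + y) = -2 * (q * r + s * t - t * (p + s)) := by linarith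
  rw [e1, e2, e3] at hX
  have e4 : q ^ 2 + s ^ 2 + t ^ 2 + (r ^ 2 + t ^ 2 + (p + s) ^ 2) = 3 / 2 * m := by linarith
  have : m ^ 2 = 0 := by linear_combination (hX - 4 * hA + 4 * m * e4) / 3
  exact pow_eq_zero_iff two_ne_zero |>.1 this

end IsotropicCubic

/-! ### Algebraic curvature tensors. -/

section Curvature

variable {V : Type*} [AddCommGroup V]

/-- The algebraic symmetries of a Riemannian curvature tensor. -/
structure IsAlgebraicCurvature (R : V → V → V → V → ℝ) : Prop where
  add : ∀ a a' b c d, R (a + a') b c d = R a b c d + R a' b c d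
  swap_left : ∀ a b c d, R a b c d = -R b a c d
  swap_right : ∀ a b c d, R a b c d = -R a b d c
  bianchi : ∀ a b c d, R a b c d + R b c a d + R c a b d = 0

namespace IsAlgebraicCurvature

variable {R : V → V → V → V → ℝ} (h : IsAlgebraicCurvature R)

include h

theorem pair_symm (a b c d : V) : R a b c d = R c d a b := by
  have h1 := h.bianchi a b c d
  have h2 := h.bianchi b c d a
  have h3 := h.bianchi c d a b
  have h4 := h.bianchi d a b c
  linarith [h.swap_right b c d a, h.swap_right c d b a, h.swap_right a b d c, h.swap_right d a c b,
    h.swap_left c a b d, h.swap_right a c b d, h.swap_left d b c a, h.swap_right b d c a]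

theorem add_second (a b b' c d : V) : R a (b + b') c d = R a b c d + R a b' c d := by
  rw [h.swap_left, h.add, h.swap_left b, h.swap_left b']
  ring

theorem add_third (a b c c' d : V) : R a b (c + c') d = R a b c d + R a b c' d := by
  rw [h.pair_symm, h.add, h.pair_symm c, h.pair_symm c']

theorem add_fourth (a b c d d' : V) : R a b c (d + d') = R a b c d + R a b c d' := by
  rw [h.swap_right, h.add_third, h.swap_right a b d, h.swap_right a b d']
  ring

/-- A curvature tensor is determined by its sectional curvatures. -/
theorem eq_zero_of_sectional_eq_zero (h0 : ∀ a b, R a b a b = 0) (a b c d : V) :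
    R a b c d = 0 := by
  have h1 : ∀ a b c, R a b a c = 0 := fun a b c => by
    have := h0 a (b + c)
    rw [h.add_second, h.add_fourth, h.add_fourth, h0, h0, h.pair_symm a c a b] at this
    linarith
  have h2 : ∀ a b c d, R a b c d = -R c b a d := fun a b c d => by
    have := h1 (a + c) b d
    rw [h.add, h.add_third, h.add_third, h1, h1] at this
    linarith
  -- R is now also skew in its first and third slots, so the three Bianchi terms are equal.
  linarith [h.bianchi a b c d, h2 a b c d, h2 b c a d, h2 c a b d, h.swap_left c b a d,
    h.swap_left a c b d, h.swap_left b a c d]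

end IsAlgebraicCurvature

end Curvature

/-! ### Curvature identities and Gray's formula for ∇²J. -/

section NearlyKahlerCurvature

set_option maxSynthPendingDepth 3

namespace IsLocalNearlyKahler

variable {E : Type*} [NormedAddCommGroup E] [NormedSpace ℝ E]
variable {U : Set E} {G : E → E →L[ℝ] E →L[ℝ] ℝ} {J : E → E →L[ℝ] E}
  {Γ : E → E →L[ℝ] E →L[ℝ] E} (h : IsLocalNearlyKahler U G J Γ) {y : E}

include h

theorem isAlgebraicCurvature (hy : y ∈ U) :
    IsAlgebraicCurvature fun a b c d => G y (localCurvature Γ y a b c) d where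
  add a a' b c d := by
    simp only [localCurvature, map_add, map_sub, add_apply, sub_apply]
    ring
  swap_left a b c d := by rw [localCurvature_swap]; simp
  swap_right a b c d := by
    have h1 := h.localCurvature_skew hy a b (c + d)
    have h2 : localCurvature Γ y a b (c + d)
        = localCurvature Γ y a b c + localCurvature Γ y a b d := by
      simp only [localCurvature, map_add]
      abel
    simp only [h2, map_add, add_apply, h.localCurvature_skew hy] at h1
    linarith
  bianchi a b c d := by
    rw [← add_apply, ← add_apply, ← map_add, ← map_add, h.localCurvature_bianchi hy]
    simp

theorem localCovJ_complex_complex (hy : y ∈ U) (u v : E) :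
    localCovJ J Γ y (J y u) (J y v) = -localCovJ J Γ y u v := by
  rw [h.localCovJ_complex hy, h.localCovJ_swap hy, h.localCovJ_complex hy, h.localCovJ_swap hy v u]
  simp [h.sq y hy]

theorem localCovJ_complex_left (hy : y ∈ U) (u v : E) :
    localCovJ J Γ y (J y u) v = localCovJ J Γ y u (J y v) := by
  rw [h.localCovJ_swap hy, h.localCovJ_complex hy, h.localCovJ_complex hy,
    h.localCovJ_swap hy v u, map_neg, neg_neg]

theorem localCovCovJ_self (hy : y ∈ U) (w u : E) : localCovCovJ J Γ y w u u = 0 := by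
  have h1 : localCovCovJ J Γ y w u u + localCovCovJ J Γ y w u u = 0 :=
    eq_neg_iff_add_eq_zero.1 (h.localCovCovJ_swap hy w u u)
  simpa [← two_smul ℝ] using h1

/-- The Ricci identity applied to w itself: the term (∇²_{u,w} J)w drops out because ∇²J inherits
the skewness of ∇J. -/
theorem covCovJ_pairing_eq_curvature (hy : y ∈ U) (w u z : E) :
    G y (localCovCovJ J Γ y w u w) (J y z) =
      G y (localCurvature Γ y w u (J y w)) (J y z) - G y (localCurvature Γ y w u w) z := by
  have h0 : localCovCovJ J Γ y u w w = 0 := h.localCovCovJ_self hy u w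
  have h1 := h.localCovCovJ_comm hy w u w
  rw [h0, sub_zero] at h1
  rw [h1, map_sub, sub_apply, h.isometry y hy]

/-- Take z = u in the preceding identity, move ∇²_{w,u} J onto Ju by skewness, and use
`localCovCovJ_complex`: as (∇_u J)u = 0 and (∇²_{w,u} J)u = 0, only (∇_u J)(∇_w J)u survives. -/
theorem curvature_sub_curvature_diag (hy : y ∈ U) (w u : E) :
    G y (localCurvature Γ y w u (J y w)) (J y u) - G y (localCurvature Γ y w u w) u =
      G y (localCovJ J Γ y w u) (localCovJ J Γ y w u) := by
  have h0 : localCovCovJ J Γ y w u u = 0 := h.localCovCovJ_self hy w u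
  have h1 : localCovJ J Γ y u u = 0 := h.skew y hy u
  rw [← h.covCovJ_pairing_eq_curvature hy]
  have h2 := h.localCovCovJ_skew hy w u w (J y u)
  have h3 := h.localCovCovJ_complex hy w u u
  rw [h0, h1] at h3
  simp only [map_zero, add_zero, neg_zero, zero_sub] at h3
  rw [h3] at h2
  have h4 := h.fderiv_complex_skew hy u w (localCovJ J Γ y w u)
  rw [h.localCovJ_swap hy u w] at h4
  simp only [map_neg, neg_apply] at h2 h4
  linarith

/-- Both sides are algebraic curvature tensors, so sectional values suffice. These agree because
|(∇_a J)b|² and R(a,b,Ja,Jb) are unchanged when a, b are replaced by Ja, Jb. -/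
theorem curvature_complex (hy : y ∈ U) (a b c d : E) :
    G y (localCurvature Γ y (J y a) (J y b) (J y c)) (J y d)
      = G y (localCurvature Γ y a b c) d := by
  have hR := h.isAlgebraicCurvature hy
  have hF : IsAlgebraicCurvature fun a b c d =>
      G y (localCurvature Γ y (J y a) (J y b) (J y c)) (J y d)
        - G y (localCurvature Γ y a b c) d :=
    { add := fun a a' b c d => by
        have h1 := hR.add (J y a) (J y a') (J y b) (J y c) (J y d)
        have h2 := hR.add a a' b c d
        simp only [map_add] at h1 h2 ⊢
        linarith
      swap_left := fun a b c d => by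
        have h1 := hR.swap_left (J y a) (J y b) (J y c) (J y d)
        have h2 := hR.swap_left a b c d
        linarith
      swap_right := fun a b c d => by
        have h1 := hR.swap_right (J y a) (J y b) (J y c) (J y d)
        have h2 := hR.swap_right a b c d
        linarith
      bianchi := fun a b c d => by
        have h1 := hR.bianchi (J y a) (J y b) (J y c) (J y d)
        have h2 := hR.bianchi a b c d
        linarith }
  have h0 := hF.eq_zero_of_sectional_eq_zero (fun a b => by
    have h1 := h.curvature_sub_curvature_diag hy a b
    have h2 := h.curvature_sub_curvature_diag hy (J y a) (J y b)
    have h3 := hR.pair_symm a b (J y a) (J y b)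
    have e : localCurvature Γ y (J y a) (J y b) (-a) = -localCurvature Γ y (J y a) (J y b) a := by
      simp only [localCurvature, map_neg]
      abel
    rw [h.localCovJ_complex_complex hy, h.sq y hy, h.sq y hy, e] at h2
    simp only [map_neg, neg_apply, neg_neg] at h1 h2 h3
    linarith) a b c d
  linarith

/-- Gray's formula for `g((∇²_{w,u} J) w, z)`. -/
theorem covCovJ_pairing (hy : y ∈ U) (w u z : E) :
    G y (localCovCovJ J Γ y w u w) z =
      G y (localCovJ J Γ y w u) (J y (localCovJ J Γ y w z)) := by
  have hR := h.isAlgebraicCurvature hy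
  -- Polarize the diagonal identity in u. J-invariance of R (`h7`) makes R(w,u,Jw,Jz) symmetric in u
  -- and z, so the mixed terms combine.
  have key : ∀ z, G y (localCovCovJ J Γ y w u w) (J y z) =
      G y (localCovJ J Γ y w u) (localCovJ J Γ y w z) := by
    intro z
    rw [h.covCovJ_pairing_eq_curvature hy]
    have h1 := h.curvature_sub_curvature_diag hy w (u + z)
    have h2 := h.curvature_sub_curvature_diag hy w u
    have h3 := h.curvature_sub_curvature_diag hy w z
    have h4 := hR.add_second w u z w
    have h5 := hR.add_second w u z (J y w)
    have h6 := hR.pair_symm w u w z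
    have h7 := h.curvature_complex hy w z (J y w) (J y u)
    have h8 := hR.pair_symm (J y w) (J y z) w u
    have e : localCurvature Γ y (J y w) (J y z) (-w) = -localCurvature Γ y (J y w) (J y z) w := by
      simp only [localCurvature, map_neg]
      abel
    have h9 := h.symm y hy (localCovJ J Γ y w u) (localCovJ J Γ y w z)
    rw [h.sq y hy, h.sq y hy, e] at h7
    simp only [map_add, add_apply, map_neg, neg_apply, neg_neg] at h1 h4 h5 h6 h7 h8
    simp only [h4, h5] at h1
    linarith
  have h1 := key (-J y z)
  simpa [h.sq y hy, h.localCovJ_complex hy] using h1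

end IsLocalNearlyKahler

end NearlyKahlerCurvature

/-! ### Orthonormal bases of a positive definite form. -/

section OrthonormalBasis

theorem exists_basis_orthonormal {V : Type*} [AddCommGroup V] [Module ℝ V] [FiniteDimensional ℝ V]
    {n : ℕ} (hn : Module.finrank ℝ V = n) (B : LinearMap.BilinForm ℝ V)
    (symm : ∀ u v, B u v = B v u) (pos : ∀ u, u ≠ 0 → 0 < B u u) :
    ∃ e : Module.Basis (Fin n) ℝ V, ∀ i j, B (e i) (e j) = if i = j then 1 else 0 := by
  subst hn
  obtain ⟨v, hv⟩ := LinearMap.BilinForm.exists_orthogonal_basis (B := B) ⟨fun u w => by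
    simpa using symm u w⟩
  have hp : ∀ i, 0 < B (v i) (v i) := fun i => pos _ (v.ne_zero i)
  refine ⟨v.isUnitSMul (w := fun i => (√(B (v i) (v i)))⁻¹)
    fun i => (inv_ne_zero (Real.sqrt_pos.2 (hp i)).ne').isUnit, fun i j => ?_⟩
  simp only [Module.Basis.isUnitSMul_apply, map_smul, LinearMap.smul_apply, smul_eq_mul]
  split_ifs with hij
  · subst hij
    have := Real.mul_self_sqrt (hp i).le
    have h0 := (Real.sqrt_pos.2 (hp i)).ne'
    field_simp
    nlinarith
  · have : B (v i) (v j) = 0 := hv hij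
    rw [this]
    simp

end OrthonormalBasis

/-! ### Minimality of Lagrangian maps and vanishing of an isotropic second fundamental form. -/

section Minimality

set_option maxSynthPendingDepth 3

variable {E : Type*} [NormedAddCommGroup E] [NormedSpace ℝ E]
  {E' : Type*} [NormedAddCommGroup E'] [NormedSpace ℝ E']
  {U : Set E} {G : E → E →L[ℝ] E →L[ℝ] ℝ} {J : E → E →L[ℝ] E}
  {Γ : E → E →L[ℝ] E →L[ℝ] E} {V : Set E'} {f : E' → E}

theorem IsLocalNearlyKahler.localCovJ_complex_left_self (h : IsLocalNearlyKahler U G J Γ) {y : E}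
    (hy : y ∈ U) (u : E) : localCovJ J Γ y (J y u) u = 0 := by
  rw [h.localCovJ_swap hy, h.localCovJ_complex hy, h.skew y hy]
  simp

namespace IsLocalIsotropicMap

variable (h : IsLocalNearlyKahler U G J Γ) (hf : IsLocalIsotropicMap V U G J f) {x : E'}

include h hf

/-- By Gray's formula the value is g((∇_w J)u, J(∇_w J)z). For tangent arguments ∇J takes values in
J of the tangent space, as σ vanishes there; so the first factor is normal and the second tangent.
-/
theorem covCovJ_eq_zero (hx : x ∈ V)
    (hspan : ∀ v, ∃ a b, v = fderiv ℝ f x a + J (f x) (fderiv ℝ f x b)) (w u z : E') :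
    G (f x) (localCovCovJ J Γ (f x) (fderiv ℝ f x w) (fderiv ℝ f x u) (fderiv ℝ f x w))
      (fderiv ℝ f x z) = 0 := by
  have hy := hf.mapsTo hx
  rw [h.covCovJ_pairing hy]
  obtain ⟨a, b, hab⟩ := hspan (localCovJ J Γ (f x) (fderiv ℝ f x w) (fderiv ℝ f x u))
  have ha : fderiv ℝ f x a = 0 := by
    by_contra hne
    have h1 := hf.covJ_eq_zero h hx w u a
    rw [hab, map_add, add_apply, hf.isotropic x hx, add_zero] at h1
    exact (h.pos _ hy _ hne).ne' h1
  rw [hab, ha, zero_add, h.isometry _ hy, h.symm _ hy, hf.covJ_eq_zero h hx]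

/-- On the tangent space σ(e₀, e_i, Je_j) is skew in i and j and zero when i = 0, so its only
independent entry is the (1,2) one, the present number up to sign. If it vanished, ∇_{e₀} J would be
zero on tangent vectors, hence on their J-images, contradicting strictness at e₀. -/
theorem covJ_complex_tangent_ne_zero (hx : x ∈ V) (e : Module.Basis (Fin 3) ℝ E')
    (hspan : ∀ v, ∃ a b, v = fderiv ℝ f x a + J (f x) (fderiv ℝ f x b))
    (hstrict : ∃ w, localCovJ J Γ (f x) (fderiv ℝ f x (e 0)) w ≠ 0) :
    G (f x) (localCovJ J Γ (f x) (J (f x) (fderiv ℝ f x (e 0))) (fderiv ℝ f x (e 1)))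
      (fderiv ℝ f x (e 2)) ≠ 0 := by
  intro h0
  have hy := hf.mapsTo hx
  have h1 : ∀ a, localCovJ J Γ (f x) (fderiv ℝ f x (e 0)) (fderiv ℝ f x a) = 0 := by
    intro a
    obtain ⟨p, q, hpq⟩ := hspan (localCovJ J Γ (f x) (fderiv ℝ f x (e 0)) (fderiv ℝ f x a))
    by_contra hne
    refine (h.pos _ hy _ hne).ne' ?_
    nth_rw 2 [hpq]
    rw [map_add, hf.covJ_eq_zero h hx, zero_add]
    have e00 := h.skew _ hy (fderiv ℝ f x (e 0))
    have key : ∀ i j, G (f x) (localCovJ J Γ (f x) (fderiv ℝ f x (e 0)) (fderiv ℝ f x (e i)))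
        (J (f x) (fderiv ℝ f x (e j))) = 0 := by
      have m1 : ∀ i j, G (f x) (localCovJ J Γ (f x) (fderiv ℝ f x (e 0)) (fderiv ℝ f x (e i)))
        (J (f x) (fderiv ℝ f x (e j))) = -G (f x) (localCovJ J Γ (f x) (fderiv ℝ f x (e 0))
          (fderiv ℝ f x (e j))) (J (f x) (fderiv ℝ f x (e i))) := by
        intro i j
        have k1 := h.fderiv_complex_skew hy (fderiv ℝ f x (e 0)) (fderiv ℝ f x (e i))
          (J (f x) (fderiv ℝ f x (e j)))
        rw [h.localCovJ_complex hy] at k1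
        simp only [map_neg] at k1
        rw [← h.metric_complex_left hy] at k1
        rw [h.symm _ hy (J (f x) (fderiv ℝ f x (e i)))] at k1
        linarith
      have m0 : ∀ j, G (f x) (localCovJ J Γ (f x) (fderiv ℝ f x (e 0)) (fderiv ℝ f x (e 0)))
        (J (f x) (fderiv ℝ f x (e j))) = 0 := by
        intro j
        rw [e00]
        simp
      have m2 : ∀ i, G (f x) (localCovJ J Γ (f x) (fderiv ℝ f x (e 0)) (fderiv ℝ f x (e i)))
        (J (f x) (fderiv ℝ f x (e i))) = 0 := by
        intro i
        linarith [m1 i i]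
      have m3 : G (f x) (localCovJ J Γ (f x) (fderiv ℝ f x (e 0)) (fderiv ℝ f x (e 1)))
        (J (f x) (fderiv ℝ f x (e 2))) = 0 := by
        rw [h.localCovJ_complex_left hy, h.localCovJ_complex hy] at h0
        simp only [map_neg, neg_apply] at h0
        rw [h.metric_complex_left hy] at h0
        linarith
      intro i j
      fin_cases i <;> fin_cases j
      · exact m0 0
      · exact m0 1
      · exact m0 2
      · exact (m1 1 0).trans (by rw [m0, neg_zero])
      · exact m2 1
      · exact m3
      · exact (m1 2 0).trans (by rw [m0, neg_zero])
      · exact (m1 2 1).trans (by rw [m3, neg_zero])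
      · exact m2 2
    rw [← e.sum_repr a, ← e.sum_repr q]
    simp [-Module.Basis.sum_repr, key]
  obtain ⟨w, hw⟩ := hstrict
  obtain ⟨a, b, rfl⟩ := hspan w
  rw [map_add, h.localCovJ_complex hy, h1, h1] at hw
  simp at hw

/-- Lagrangian maps into a strict nearly Kähler 6-manifold are minimal. -/
theorem trace_hessian_eq_zero (hx : x ∈ V) (e : Module.Basis (Fin 3) ℝ E')
    (he : ∀ i j, G (f x) (fderiv ℝ f x (e i)) (fderiv ℝ f x (e j)) = if i = j then 1 else 0)
    (hspan : ∀ v, ∃ a b, v = fderiv ℝ f x a + J (f x) (fderiv ℝ f x b))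
    (hstrict : ∃ w, localCovJ J Γ (f x) (fderiv ℝ f x (e 0)) w ≠ 0) (i : Fin 3) :
    ∑ k, G (f x) (J (f x) (localHessian Γ f x (e i) (e k))) (fderiv ℝ f x (e k)) = 0 := by
  have hy := hf.mapsTo hx
  have hτ := hf.covJ_complex_tangent_ne_zero h hx e hspan hstrict
  set τ := G (f x) (localCovJ J Γ (f x) (J (f x) (fderiv ℝ f x (e 0))) (fderiv ℝ f x (e 1)))
      (fderiv ℝ f x (e 2)) with hτdef
  -- The direction e_i repeats one of e₀, e₁, e₂; skewness of ∇²J brings the repeated vector to the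
  -- slot required by `covCovJ_eq_zero`.
  have hS : G (f x) (localCovCovJ J Γ (f x) (fderiv ℝ f x (e i)) (fderiv ℝ f x (e 0))
      (fderiv ℝ f x (e 1))) (fderiv ℝ f x (e 2)) = 0 := by
    have z := hf.covCovJ_eq_zero h hx hspan
    fin_cases i
    · have := z (e 0) (e 1) (e 2)
      rw [h.localCovCovJ_swap hy] at this
      simpa using this
    · exact z (e 1) (e 0) (e 2)
    · have h1 := z (e 2) (e 0) (e 1)
      have h2 := h.localCovCovJ_skew hy (fderiv ℝ f x (e 2)) (fderiv ℝ f x (e 0))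
        (fderiv ℝ f x (e 1)) (fderiv ℝ f x (e 2))
      rw [h.symm _ hy (fderiv ℝ f x (e 1)), h1, add_zero] at h2
      exact h2
  have hsum := hf.covCovJ_add_covJ_hessian h hx (e i) (e 0) (e 1) (e 2)
  rw [hS, zero_add] at hsum
  -- Split the Hessian as p + Jq. The tangential p will drop out of σ, and orthonormality reads off
  -- the k-th coordinate of q as -C(e_i, e_k, e_k).
  have hdec : ∀ k, ∃ p q, localHessian Γ f x (e i) (e k) =
      fderiv ℝ f x p + J (f x) (fderiv ℝ f x q) ∧ e.repr q k =
        -G (f x) (J (f x) (localHessian Γ f x (e i) (e k))) (fderiv ℝ f x (e k)) := by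
    intro k
    obtain ⟨p, q, hpq⟩ := hspan (localHessian Γ f x (e i) (e k))
    refine ⟨p, q, hpq, ?_⟩
    rw [hpq, map_add, map_add, add_apply, hf.isotropic x hx, h.sq _ hy]
    nth_rw 2 [← e.sum_repr q]
    simp [-Module.Basis.sum_repr, he]
  obtain ⟨p0, q0, hd0, hq0⟩ := hdec 0
  obtain ⟨p1, q1, hd1, hq1⟩ := hdec 1
  obtain ⟨p2, q2, hd2, hq2⟩ := hdec 2
  have n0 : ∀ a b, localCovJ J Γ (f x) (J (f x) a) b = - localCovJ J Γ (f x) (J (f x) b) a := by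
    intro a b
    rw [h.localCovJ_complex_left hy, h.localCovJ_complex_left hy, h.localCovJ_complex hy,
      h.localCovJ_complex hy, h.localCovJ_swap hy a b, map_neg]
  have n1 : ∀ a b c, G (f x) (localCovJ J Γ (f x) (J (f x) a) b) c
      = - G (f x) (localCovJ J Γ (f x) (J (f x) a) c) b := by
    intro a b c
    have := h.fderiv_complex_skew hy (J (f x) a) b c
    rw [h.symm _ hy b] at this
    linarith
  have n2 : ∀ a b, G (f x) (localCovJ J Γ (f x) (J (f x) a) b) a = 0 := by
    intro a b
    rw [n1, h.localCovJ_complex_left_self hy]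
    simp
  have n3 : ∀ a b, G (f x) (localCovJ J Γ (f x) (J (f x) a) b) b = 0 := by
    intro a b
    linarith [n1 a b b]
  -- By `n0` to `n3`, (q,u,v) ↦ σ(Jq,u,v) is alternating on the three-dimensional tangent space, so
  -- each Hessian term is one coordinate of q times τ, with the sign of the permutation.
  have s0 : ∀ q, G (f x) (localCovJ J Γ (f x) (J (f x) (fderiv ℝ f x q)) (fderiv ℝ f x (e 1)))
      (fderiv ℝ f x (e 2)) = e.repr q 0 * τ := by
    intro q
    nth_rw 1 [← e.sum_repr q]
    simp [-Module.Basis.sum_repr, Fin.sum_univ_three, h.localCovJ_complex_left_self hy, n2, hτdef]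
  have s1 : ∀ q, G (f x) (localCovJ J Γ (f x) (J (f x) (fderiv ℝ f x q)) (fderiv ℝ f x (e 0)))
      (fderiv ℝ f x (e 2)) = - (e.repr q 1 * τ) := by
    intro q
    nth_rw 1 [← e.sum_repr q]
    rw [hτdef, n0 (fderiv ℝ f x (e 0))]
    simp [-Module.Basis.sum_repr, Fin.sum_univ_three, h.localCovJ_complex_left_self hy, n2]
  have s2 : ∀ q, G (f x) (localCovJ J Γ (f x) (J (f x) (fderiv ℝ f x q)) (fderiv ℝ f x (e 0)))
      (fderiv ℝ f x (e 1)) = e.repr q 2 * τ := by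
    intro q
    nth_rw 1 [← e.sum_repr q]
    have : G (f x) (localCovJ J Γ (f x) (J (f x) (fderiv ℝ f x (e 2))) (fderiv ℝ f x (e 0)))
      (fderiv ℝ f x (e 1)) = τ := by
      rw [hτdef, n0, map_neg, neg_apply, n1, neg_neg]
    simp [-Module.Basis.sum_repr, Fin.sum_univ_three, h.localCovJ_complex_left_self hy, n2, this]
  have r0 : G (f x) (localCovJ J Γ (f x) (localHessian Γ f x (e i) (e 0)) (fderiv ℝ f x (e 1)))
      (fderiv ℝ f x (e 2)) = e.repr q0 0 * τ := by
    rw [hd0, map_add, add_apply, map_add, add_apply, hf.covJ_eq_zero h hx, zero_add, s0]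
  have r1 : G (f x) (localCovJ J Γ (f x) (fderiv ℝ f x (e 0)) (localHessian Γ f x (e i) (e 1)))
      (fderiv ℝ f x (e 2)) = e.repr q1 1 * τ := by
    rw [hd1, map_add, map_add, add_apply, hf.covJ_eq_zero h hx, zero_add, h.localCovJ_swap hy,
      map_neg, neg_apply, s1, neg_neg]
  have r2 : G (f x) (localCovJ J Γ (f x) (fderiv ℝ f x (e 0)) (fderiv ℝ f x (e 1)))
      (localHessian Γ f x (e i) (e 2)) = e.repr q2 2 * τ := by
    rw [hd2, map_add, hf.covJ_eq_zero h hx, zero_add, ← s2, h.symm _ hy]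
    have k1 := h.fderiv_complex_skew hy (fderiv ℝ f x (e 0)) (J (f x) (fderiv ℝ f x q2)) (fderiv ℝ f x (e 1))
    rw [h.localCovJ_swap hy (J (f x) (fderiv ℝ f x q2))]
    simp only [map_neg, neg_apply]
    linarith
  rw [r0, r1, r2, hq0, hq1, hq2] at hsum
  rw [Fin.sum_univ_three]
  have : (G (f x) (J (f x) (localHessian Γ f x (e i) (e 0))) (fderiv ℝ f x (e 0))
    + G (f x) (J (f x) (localHessian Γ f x (e i) (e 1))) (fderiv ℝ f x (e 1))
    + G (f x) (J (f x) (localHessian Γ f x (e i) (e 2))) (fderiv ℝ f x (e 2))) * τ = 0 := by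
    linarith
  exact (mul_eq_zero.1 this).resolve_right hτ

/-- If the second fundamental form `n` of a Lagrangian map is isotropic at `x`, it vanishes
there. -/
theorem normal_eq_zero_of_isotropic (hx : x ∈ V)
    (e : Module.Basis (Fin 3) ℝ E')
    (he : ∀ i j, G (f x) (fderiv ℝ f x (e i)) (fderiv ℝ f x (e j)) = if i = j then 1 else 0)
    (hspan : ∀ v, ∃ a b, v = fderiv ℝ f x a + J (f x) (fderiv ℝ f x b))
    (hstrict : ∃ w, localCovJ J Γ (f x) (fderiv ℝ f x (e 0)) w ≠ 0)
    (n : E' → E' → E)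
    (hn : ∀ v w, ∃ p q, n v w = J (f x) (fderiv ℝ f x q) ∧
      localHessian Γ f x v w = fderiv ℝ f x p + n v w) (m : ℝ)
    (hiso : ∀ v, G (f x) (n v v) (n v v) = m * G (f x) (fderiv ℝ f x v) (fderiv ℝ f x v) ^ 2)
    (v w : E') : n v w = 0 := by
  have hy := hf.mapsTo hx
  let C : E' → E' → E' → ℝ := fun a b c =>
    G (f x) (J (f x) (localHessian Γ f x a b)) (fderiv ℝ f x c)
  have hC : ∀ a b c, C a b c = G (f x) (J (f x) (localHessian Γ f x a b)) (fderiv ℝ f x c) :=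
    fun _ _ _ => rfl
  have c12 : ∀ a b c, C a b c = C b a c := fun a b c => by
    rw [hC, hf.localHessian_symm h hx]
  have c23 : ∀ a b c, C a b c = C a c b := fun a b c => hf.hessian_totally_symm h hx a b c
  have hq : ∀ v w, ∃ q, n v w = J (f x) (fderiv ℝ f x q) ∧ ∀ k, e.repr q k = -C v w (e k) := by
    intro v w
    obtain ⟨p, q, h1, h2⟩ := hn v w
    refine ⟨q, h1, fun k => ?_⟩
    rw [hC, h2, h1, map_add, map_add, add_apply, hf.isotropic x hx, h.sq _ hy]
    nth_rw 2 [← e.sum_repr q]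
    simp [-Module.Basis.sum_repr, he]
  have hnorm : ∀ q, G (f x) (fderiv ℝ f x q) (fderiv ℝ f x q)
      = e.repr q 0 ^ 2 + e.repr q 1 ^ 2 + e.repr q 2 ^ 2 := by
    intro q
    nth_rw 1 2 [← e.sum_repr q]
    simp [-Module.Basis.sum_repr, Fin.sum_univ_three, he]
    ring
  have hnn : ∀ v, C v v (e 0) ^ 2 + C v v (e 1) ^ 2 + C v v (e 2) ^ 2
      = m * (e.repr v 0 ^ 2 + e.repr v 1 ^ 2 + e.repr v 2 ^ 2) ^ 2 := by
    intro v
    obtain ⟨q, h1, h2⟩ := hq v v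
    rw [← hnorm v, ← hiso, h1, h.isometry _ hy, hnorm, h2, h2, h2]
    ring
  have cadd : ∀ a a' b c, C (a + a') b c = C a b c + C a' b c := by
    intro a a' b c
    simp [hC, localHessian]
    ring
  have csmul : ∀ (t : ℝ) a b c, C (t • a) b c = t * C a b c := by
    intro t a b c
    simp [hC, localHessian]
    ring
  have hm : m = 0 := by
    have tr := hf.trace_hessian_eq_zero h hx e he hspan hstrict
    have t1 := tr 0
    have t2 := tr 1
    have t3 := tr 2
    simp only [Fin.sum_univ_three, ← hC] at t1 t2 t3
    have cadd2 : ∀ a a' b c, C b (a + a') c = C b a c + C b a' c := by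
      intro a a' b c
      rw [c12, cadd, c12 a, c12 a']
    have csmul2 : ∀ (t : ℝ) a b c, C b (t • a) c = t * C b a c := by
      intro t a b c
      rw [c12, csmul, c12 a]
    -- Sort the indices of C, leaving the ten independent coefficients of the cubic.
    have i1 : C (e 1) (e 0) (e 0) = C (e 0) (e 0) (e 1) := by rw [c12, c23]
    have i2 : C (e 1) (e 0) (e 1) = C (e 0) (e 1) (e 1) := by rw [c12]
    have i3 : C (e 2) (e 0) (e 0) = C (e 0) (e 0) (e 2) := by rw [c12, c23]
    have i4 : C (e 2) (e 0) (e 2) = C (e 0) (e 2) (e 2) := by rw [c12]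
    have i5 : C (e 2) (e 1) (e 1) = C (e 1) (e 1) (e 2) := by rw [c12, c23]
    have i6 : C (e 2) (e 1) (e 2) = C (e 1) (e 2) (e 2) := by rw [c12]
    have i7 : C (e 0) (e 1) (e 0) = C (e 0) (e 0) (e 1) := by rw [c23]
    have i8 : C (e 0) (e 2) (e 0) = C (e 0) (e 0) (e 2) := by rw [c23]
    have i9 : C (e 0) (e 2) (e 1) = C (e 0) (e 1) (e 2) := by rw [c23]
    have i10 : C (e 1) (e 0) (e 2) = C (e 0) (e 1) (e 2) := by rw [c12]
    have i11 : C (e 1) (e 2) (e 0) = C (e 0) (e 1) (e 2) := by rw [c23, c12]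
    have i12 : C (e 2) (e 0) (e 1) = C (e 0) (e 1) (e 2) := by rw [c12, c23]
    have i13 : C (e 2) (e 1) (e 0) = C (e 0) (e 1) (e 2) := by rw [c23, c12, c23]
    have i14 : C (e 1) (e 1) (e 0) = C (e 0) (e 1) (e 1) := by rw [c23, c12]
    have i15 : C (e 2) (e 2) (e 0) = C (e 0) (e 2) (e 2) := by rw [c23, c12]
    have i16 : C (e 1) (e 2) (e 1) = C (e 1) (e 1) (e 2) := by rw [c23]
    have i17 : C (e 2) (e 2) (e 1) = C (e 1) (e 2) (e 2) := by rw [c23, c12]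
    simp only [i1, i3, i5] at t1 t2 t3
    -- The coefficient t occurs in none of the trace conditions, so it is supplied explicitly.
    refine eq_zero_of_isotropic_coefficients (t := C (e 0) (e 1) (e 2)) t1 t2 t3 fun a b c => ?_
    have := hnn (a • e 0 + b • e 1 + c • e 2)
    simp only [cadd, csmul, cadd2, csmul2, i1, i2, i3, i4, i5, i6, i7, i8, i9, i10, i11, i12, i13,
      i14, i15, i16, i17] at this
    simp at this
    linarith
  have hdiag : ∀ v k, C v v (e k) = 0 := by
    intro v k
    have := hnn v
    rw [hm, zero_mul] at this
    have h0 : C v v (e 0) = 0 := by nlinarith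
    have h1 : C v v (e 1) = 0 := by nlinarith
    have h2 : C v v (e 2) = 0 := by nlinarith
    fin_cases k
    exacts [h0, h1, h2]
  have hall : ∀ v w k, C v w (e k) = 0 := by
    intro v w k
    have h1 := hdiag (v + w) k
    rw [cadd, c12 v, c12 w, cadd, cadd, hdiag, hdiag, c12 w v] at h1
    linarith
  obtain ⟨q, h1, h2⟩ := hq v w
  have : q = 0 := e.repr.injective (by ext k; rw [h2, hall]; simp)
  rw [h1, this]
  simp

end IsLocalIsotropicMap

end Minimality

/-! ### Christoffel symbols of a metric on an open set. -/

section LocalChristoffel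

set_option maxSynthPendingDepth 3

variable {E : Type*} [NormedAddCommGroup E] [NormedSpace ℝ E]

/-- `(u, v, w) ↦ ½ (D_u G(v, w) + D_v G(u, w) - D_w G(u, v))`, the Christoffel symbols of the
first kind. -/
def localKoszul (G : E → E →L[ℝ] E →L[ℝ] ℝ) (y : E) : E →L[ℝ] E →L[ℝ] E →L[ℝ] ℝ :=
  (1 / 2 : ℝ) • (fderiv ℝ G y + (fderiv ℝ G y).flip
    - (ContinuousLinearMap.flipₗᵢ ℝ E E ℝ).toLinearIsometry.toContinuousLinearMap.comp
      (fderiv ℝ G y).flip)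

theorem localKoszul_apply (G : E → E →L[ℝ] E →L[ℝ] ℝ) (y u v w : E) :
    localKoszul G y u v w =
      1 / 2 * (fderiv ℝ G y u v w + fderiv ℝ G y v u w - fderiv ℝ G y w u v) := rfl

/-- The Christoffel symbols of a metric on an open set of a vector space. -/
def localChristoffel (G : E → E →L[ℝ] E →L[ℝ] ℝ) (y : E) : E →L[ℝ] E →L[ℝ] E :=
  (ContinuousLinearMap.compL ℝ E (E →L[ℝ] ℝ) E (G y).inverse).comp (localKoszul G y)

variable [FiniteDimensional ℝ E]

theorem isInvertible_of_pos {B : E →L[ℝ] E →L[ℝ] ℝ} (hB : ∀ u, u ≠ 0 → 0 < B u u) :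
    B.IsInvertible := by
  have hinj : Function.Injective B.toLinearMap := by
    rw [← LinearMap.ker_eq_bot, LinearMap.ker_eq_bot']
    intro v hv
    by_contra h
    have h0 : B v v = 0 := congrArg (fun l : E →L[ℝ] ℝ => l v) hv
    exact (hB v h).ne' h0
  have hfin : Module.finrank ℝ E = Module.finrank ℝ (E →L[ℝ] ℝ) := by
    rw [← (LinearMap.toContinuousLinearMap (𝕜 := ℝ) (E := E) (F' := ℝ)).finrank_eq]
    exact (Subspace.dual_finrank_eq (K := ℝ) (V := E)).symm
  have hbij : Function.Bijective B.toLinearMap :=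
    ⟨hinj, (LinearMap.injective_iff_surjective_of_finrank_eq_finrank hfin).1 hinj⟩
  refine ⟨(LinearEquiv.ofBijective B.toLinearMap hbij).toContinuousLinearEquiv, ?_⟩
  ext u v
  rfl

variable {G : E → E →L[ℝ] E →L[ℝ] ℝ}

theorem metric_localChristoffel {y : E} (pos : ∀ u, u ≠ 0 → 0 < G y u u) (u v w : E) :
    G y (localChristoffel G y u v) w = localKoszul G y u v w := by
  have h := isInvertible_of_pos pos
  change G y ((G y).inverse (localKoszul G y u v)) w = _
  rw [h.self_apply_inverse]

theorem contDiffOn_localChristoffel {U : Set E} (hU : IsOpen U) (hG : ContDiffOn ℝ ∞ G U)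
    (pos : ∀ y ∈ U, ∀ u, u ≠ 0 → 0 < G y u u) : ContDiffOn ℝ ∞ (localChristoffel G) U := by
  intro y hy
  have hGy := hG.contDiffAt (hU.mem_nhds hy)
  have hD : ContDiffAt ℝ ∞ (fderiv ℝ G) y := hGy.fderiv_right (m := ∞) (by simp)
  have hflip : ContDiffAt ℝ ∞ (fun y => (fderiv ℝ G y).flip) y :=
    (ContinuousLinearMap.flipₗᵢ ℝ E E (E →L[ℝ] ℝ)).contDiff.contDiffAt.comp y hD
  have hK : ContDiffAt ℝ ∞ (localKoszul G) y :=
    ((hD.add hflip).sub ((contDiffAt_const (c := (ContinuousLinearMap.flipₗᵢ ℝ E E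
      ℝ).toLinearIsometry.toContinuousLinearMap)).clm_comp hflip)).const_smul (1 / 2 : ℝ)
  have hinv : ContDiffAt ℝ ∞ (fun y => (G y).inverse) y := by
    obtain ⟨e, he⟩ := isInvertible_of_pos (pos y hy)
    have := contDiffAt_map_inverse (n := ∞) e
    rw [he] at this
    exact this.comp y hGy
  have hc : ContDiffAt ℝ ∞
      (fun y => ContinuousLinearMap.compL ℝ E (E →L[ℝ] ℝ) E (G y).inverse) y :=
    (ContinuousLinearMap.compL ℝ E (E →L[ℝ] ℝ) E).contDiff.contDiffAt.comp y hinv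
  exact (hc.clm_comp hK).contDiffWithinAt

omit [FiniteDimensional ℝ E] in
theorem fderiv_metric_symm {U : Set E} (hU : IsOpen U) (hG : ContDiffOn ℝ ∞ G U)
    (symm : ∀ y ∈ U, ∀ u v, G y u v = G y v u) {y : E} (hy : y ∈ U) (w u v : E) :
    fderiv ℝ G y w u v = fderiv ℝ G y w v u := by
  have hd := ((hG.contDiffAt (hU.mem_nhds hy)).differentiableAt (by simp)).hasFDerivAt
  have h1 := hasFDerivAt_clm_apply_const (hasFDerivAt_clm_apply_const hd u) v
  have h2 := hasFDerivAt_clm_apply_const (hasFDerivAt_clm_apply_const hd v) u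
  have h3 := HasFDerivAt.apply_eq_zero_of_eventually_eq (c := 0) (h1.sub h2)
    (Filter.mem_of_superset (hU.mem_nhds hy) fun z hz => by simp [symm z hz u v]) w
  simpa [sub_eq_zero] using h3

omit [FiniteDimensional ℝ E] in
theorem localChristoffel_symm {U : Set E} (hU : IsOpen U) (hG : ContDiffOn ℝ ∞ G U)
    (symm : ∀ y ∈ U, ∀ u v, G y u v = G y v u) {y : E} (hy : y ∈ U) (u v : E) :
    localChristoffel G y u v = localChristoffel G y v u := by
  have h : localKoszul G y u v = localKoszul G y v u := by
    ext w
    rw [localKoszul_apply, localKoszul_apply, fderiv_metric_symm hU hG symm hy w u v]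
    ring
  change (G y).inverse (localKoszul G y u v) = (G y).inverse (localKoszul G y v u)
  rw [h]

theorem localChristoffel_metric {U : Set E} (hU : IsOpen U) (hG : ContDiffOn ℝ ∞ G U)
    (symm : ∀ y ∈ U, ∀ u v, G y u v = G y v u) (pos : ∀ y ∈ U, ∀ u, u ≠ 0 → 0 < G y u u)
    {y : E} (hy : y ∈ U) (w u v : E) :
    fderiv ℝ G y w u v =
      G y (localChristoffel G y w u) v + G y u (localChristoffel G y w v) := by
  rw [symm y hy u, metric_localChristoffel (pos y hy), metric_localChristoffel (pos y hy),
    localKoszul_apply, localKoszul_apply, fderiv_metric_symm hU hG symm hy w v u,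
    fderiv_metric_symm hU hG symm hy u w v, fderiv_metric_symm hU hG symm hy v w u]
  ring

end LocalChristoffel

/-! ### Coordinate frames of the tangent bundle in a chart. -/

section Chart

set_option maxSynthPendingDepth 3

variable {E : Type*} [NormedAddCommGroup E] [NormedSpace ℝ E]
  {H : Type*} [TopologicalSpace H] {I : ModelWithCorners ℝ E H}
  {N : Type*} [TopologicalSpace N] [ChartedSpace H N] [IsManifold I ∞ N]

variable (I) in
/-- The local frame at `x` given by the trivialization of the tangent bundle at `p`. -/
def frame (p x : N) : E →L[ℝ] TangentSpace I x :=
  (trivializationAt E (TangentSpace I : N → Type _) p).symmL ℝ x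

variable (I) in
/-- The components of a tangent vector at `x` in the trivialization of the tangent bundle
at `p`. -/
def coframe (p x : N) : TangentSpace I x →L[ℝ] E :=
  (trivializationAt E (TangentSpace I : N → Type _) p).continuousLinearMapAt ℝ x

variable {p x : N}

theorem coframe_frame (hx : x ∈ (chartAt H p).source) (v : E) :
    coframe I p x (frame I p x v) = v :=
  (trivializationAt E (TangentSpace I : N → Type _) p).continuousLinearMapAt_symmL
    (by simpa using hx) v

theorem frame_coframe (hx : x ∈ (chartAt H p).source) (v : TangentSpace I x) :
    frame I p x (coframe I p x v) = v :=
  (trivializationAt E (TangentSpace I : N → Type _) p).symmL_continuousLinearMapAt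
    (by simpa using hx) v

theorem trivialization_apply_eq_coframe (hx : x ∈ (chartAt H p).source) (v : TangentSpace I x) :
    (trivializationAt E (TangentSpace I : N → Type _) p ⟨x, v⟩).2 = coframe I p x v := by
  rw [coframe, Bundle.Trivialization.continuousLinearMapAt_apply,
    Bundle.Trivialization.coe_linearMapAt_of_mem _ (by simpa using hx)]

theorem coframe_eq_mfderiv (hx : x ∈ (chartAt H p).source) :
    coframe I p x = mfderiv I 𝓘(ℝ, E) (extChartAt I p) x :=
  TangentBundle.continuousLinearMapAt_trivializationAt hx

theorem eventually_mem_chart_source (hx : x ∈ (chartAt H p).source) :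
    ∀ᶠ z in 𝓝 x, z ∈ (chartAt H p).source := (chartAt H p).open_source.mem_nhds hx

theorem contMDiffAt_frame (hx : x ∈ (chartAt H p).source) (v : E) :
    CMDiffAt ∞ (T% fun z => frame I p z v) x := by
  rw [(trivializationAt E (TangentSpace I : N → Type _) p).contMDiffAt_section_iff
    (by simpa using hx)]
  refine (contMDiffAt_const (c := v)).congr_of_eventuallyEq ?_
  filter_upwards [eventually_mem_chart_source hx] with z hz
  rw [trivialization_apply_eq_coframe hz, coframe_frame hz]

theorem mdifferentiableAt_frame (hx : x ∈ (chartAt H p).source) (v : E) :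
    MDiffAt (T% fun z => frame I p z v) x :=
  (contMDiffAt_frame hx v).mdifferentiableAt (by simp)

theorem extend_eq_frame (v : TangentSpace I p) (hx : x ∈ (chartAt H p).source) :
    extend E v x = frame I p x (coframe I p p v) := by
  rw [← trivialization_apply_eq_coframe (mem_chart_source H p), frame,
    Bundle.Trivialization.symmL_apply _ (by simpa using hx)]
  rfl

theorem mvfderiv_eq_fderiv {F : Type*} [NormedAddCommGroup F] [NormedSpace ℝ F]
    (hx : x ∈ (chartAt H p).source) {k : N → F} {K : E → F}
    (hK : DifferentiableAt ℝ K (extChartAt I p x))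
    (hk : ∀ᶠ z in 𝓝 x, k z = K (extChartAt I p z)) (w : TangentSpace I x) :
    mvfderiv I k x w = fderiv ℝ K (extChartAt I p x) (coframe I p x w) := by
  have h1 : MDifferentiableAt I 𝓘(ℝ, E) (extChartAt I p) x := mdifferentiableAt_extChartAt hx
  have h2 : MDifferentiableAt 𝓘(ℝ, E) 𝓘(ℝ, F) K (extChartAt I p x) := hK.mdifferentiableAt
  have h3 : k =ᶠ[𝓝 x] K ∘ extChartAt I p := hk
  rw [coframe_eq_mfderiv hx, mvfderiv]
  rw [h3.mfderiv_eq, mfderiv_comp x h2 h1, mfderiv_eq_fderiv]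
  rfl

/-- A constant vector field on a vector space. -/
def constantField (w : E) : Π y : E, TangentSpace 𝓘(ℝ, E) y := fun _ => w

theorem mdifferentiableAt_constantField (w y : E) :
    MDifferentiableAt 𝓘(ℝ, E) (𝓘(ℝ, E).prod 𝓘(ℝ, E))
      (fun y : E => (TotalSpace.mk' E y (constantField w y) :
        TotalSpace E (TangentSpace 𝓘(ℝ, E) : E → Type _))) y := by
  rw [mdifferentiableAt_section]
  refine (mdifferentiableAt_const (c := w)).congr_of_eventuallyEq ?_
  filter_upwards with z
  simp [constantField]

theorem mlieBracket_constantField (u v : E) :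
    mlieBracket 𝓘(ℝ, E) (constantField u) (constantField v) = 0 := by
  funext y
  rw [← mlieBracketWithin_univ, mlieBracketWithin_eq_lieBracketWithin]
  change lieBracketWithin ℝ (fun _ : E => u) (fun _ : E => v) Set.univ y = 0
  simp [lieBracketWithin]

/-- Frame fields are coordinate fields: near x they are pullbacks of constant fields under the
chart, and brackets commute with pullback. -/
theorem mlieBracket_frame [FiniteDimensional ℝ E] (hx : x ∈ (chartAt H p).source) (u v : E) :
    mlieBracket I (fun z => frame I p z u) (fun z => frame I p z v) x = 0 := by
  have key : ∀ w : E, (fun z => frame I p z w) =ᶠ[𝓝 x]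
      mpullback I 𝓘(ℝ, E) (extChartAt I p) (constantField w) := by
    intro w
    filter_upwards [eventually_mem_chart_source hx] with z hz
    have hinv := isInvertible_mfderiv_extChartAt (I := I) (x := p) (y := z)
      (by rwa [extChartAt_source])
    rw [mpullback_apply]
    refine (hinv.inverse_apply_eq.2 ?_).symm
    rw [← coframe_eq_mfderiv hz]
    exact (coframe_frame hz w).symm
  have : IsManifold I (minSmoothness ℝ 2) N :=
    IsManifold.of_le (n := ∞) (by simpa using ENat.LEInfty.out)
  rw [(key u).mlieBracket_vectorField_eq (key v),
    ← mpullback_mlieBracket (n := ∞) (mdifferentiableAt_constantField u _)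
      (mdifferentiableAt_constantField v _) (contMDiffAt_extChartAt' hx)
      (by simpa using ENat.LEInfty.out), mlieBracket_constantField]
  simp

end Chart

/-! ### The metric and J in a chart. -/

section ChartTensors

set_option maxSynthPendingDepth 3

variable {E : Type*} [NormedAddCommGroup E] [NormedSpace ℝ E]
  {H : Type*} [TopologicalSpace H] {I : ModelWithCorners ℝ E H}
  {N : Type*} [TopologicalSpace N] [ChartedSpace H N] [IsManifold I ∞ N]
  (g : ContMDiffRiemannianMetric I ∞ E (fun x : N => TangentSpace I x))
  (J : Π x : N, TangentSpace I x →L[ℝ] TangentSpace I x)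

/-- The metric in the coordinates of the chart at `p`. -/
def chartMetric (p : N) (y : E) : E →L[ℝ] E →L[ℝ] ℝ :=
  ContinuousLinearMap.bilinearComp
    (show E →L[ℝ] E →L[ℝ] ℝ from g.inner ((extChartAt I p).symm y))
    (show E →L[ℝ] E from frame I p ((extChartAt I p).symm y))
    (show E →L[ℝ] E from frame I p ((extChartAt I p).symm y))

/-- A field of endomorphisms in the coordinates of the chart at `p`. -/
def chartEndomorphism (p : N) (y : E) : E →L[ℝ] E :=
  (coframe I p ((extChartAt I p).symm y)).comp
    ((J ((extChartAt I p).symm y)).comp (frame I p ((extChartAt I p).symm y)))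

variable {p x : N}

theorem chartMetric_def (p : N) (y u v : E) : chartMetric g p y u v =
    g.inner ((extChartAt I p).symm y) (frame I p ((extChartAt I p).symm y) u)
      (frame I p ((extChartAt I p).symm y) v) := rfl

theorem chartMetric_apply (hx : x ∈ (chartAt H p).source) (u v : E) :
    chartMetric g p (extChartAt I p x) u v = g.inner x (frame I p x u) (frame I p x v) := by
  change g.inner _ (frame I p ((extChartAt I p).symm (extChartAt I p x)) u) (frame I p _ v) = _
  rw [(extChartAt I p).left_inv (by rwa [extChartAt_source])]

theorem chartEndomorphism_apply (hx : x ∈ (chartAt H p).source) (v : E) :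
    chartEndomorphism J p (extChartAt I p x) v = coframe I p x (J x (frame I p x v)) := by
  change coframe I p ((extChartAt I p).symm (extChartAt I p x)) (J _ (frame I p _ v)) = _
  rw [(extChartAt I p).left_inv (by rwa [extChartAt_source])]

omit [IsManifold I ∞ N] in
theorem mem_extChartAt_target (hx : x ∈ (chartAt H p).source) :
    extChartAt I p x ∈ (extChartAt I p).target :=
  (extChartAt I p).map_source (by rwa [extChartAt_source])

theorem contMDiffAt_inner_frame (hx : x ∈ (chartAt H p).source) (u v : E) :
    ContMDiffAt I 𝓘(ℝ, ℝ) ∞ (fun z => g.inner z (frame I p z u) (frame I p z v)) x := by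
  have : ContMDiffAt I (I.prod 𝓘(ℝ)) ∞
      (fun m ↦ TotalSpace.mk' ℝ (E := Bundle.Trivial N ℝ) m
        (g.inner m (frame I p m u) (frame I p m v))) x :=
    ContMDiffAt.clm_bundle_apply₂ (F₁ := E) (F₂ := E) (g.contMDiff x) (contMDiffAt_frame hx u)
      (contMDiffAt_frame hx v)
  simp only [contMDiffAt_totalSpace] at this
  exact this.2

variable {J} in
theorem contMDiffAt_coframe_endomorphism (hJ : ContMDiff I (I.prod 𝓘(ℝ, E →L[ℝ] E)) ∞
    (fun x => TotalSpace.mk' (E →L[ℝ] E)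
      (E := fun x : N => TangentSpace I x →L[ℝ] TangentSpace I x) x (J x)))
    (hx : x ∈ (chartAt H p).source) (v : E) :
    ContMDiffAt I 𝓘(ℝ, E) ∞ (fun z => coframe I p z (J z (frame I p z v))) x := by
  have h1 : CMDiffAt ∞ (T% fun z => J z (frame I p z v)) x :=
    ContMDiffAt.clm_bundle_apply (F₁ := E) (F₂ := E) (hJ x) (contMDiffAt_frame hx v)
  rw [(trivializationAt E (TangentSpace I : N → Type _) p).contMDiffAt_section_iff
    (by simpa using hx)] at h1
  refine h1.congr_of_eventuallyEq ?_
  filter_upwards [eventually_mem_chart_source hx] with z hz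
  rw [trivialization_apply_eq_coframe hz]

theorem contDiffOn_comp_extChartAt_symm [I.Boundaryless] {F : Type*} [NormedAddCommGroup F]
    [NormedSpace ℝ F] {k : N → F}
    (hk : ∀ x ∈ (chartAt H p).source, ContMDiffAt I 𝓘(ℝ, F) ∞ k x) :
    ContDiffOn ℝ ∞ (fun y => k ((extChartAt I p).symm y)) (extChartAt I p).target := by
  rw [← contMDiffOn_iff_contDiffOn]
  refine ContMDiffOn.comp (t := (chartAt H p).source)
    (fun x hx => (hk x hx).contMDiffWithinAt) (contMDiffOn_extChartAt_symm p) ?_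
  intro y hy
  have := (extChartAt I p).map_target hy
  rwa [extChartAt_source] at this

theorem chartMetric_symm {y : E} (u v : E) : chartMetric g p y u v = chartMetric g p y v u := by
  rw [chartMetric_def, chartMetric_def, g.symm]

theorem chartMetric_pos {y : E} (hy : y ∈ (extChartAt I p).target) (u : E) (hu : u ≠ 0) :
    0 < chartMetric g p y u u := by
  rw [chartMetric_def]
  refine g.pos _ _ fun h0 => hu ?_
  have hx : (extChartAt I p).symm y ∈ (chartAt H p).source := by
    simpa using (extChartAt I p).map_target hy
  rw [← coframe_frame (I := I) hx u]
  exact (congrArg _ h0).trans (map_zero _)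

variable [FiniteDimensional ℝ E]

theorem contDiffOn_chartMetric [I.Boundaryless] :
    ContDiffOn ℝ ∞ (chartMetric g p) (extChartAt I p).target := by
  rw [contDiffOn_clm_apply]
  intro u
  rw [contDiffOn_clm_apply]
  intro v
  exact contDiffOn_comp_extChartAt_symm fun x hx => contMDiffAt_inner_frame g hx u v

variable {J} in
theorem contDiffOn_chartEndomorphism [I.Boundaryless]
    (hJ : ContMDiff I (I.prod 𝓘(ℝ, E →L[ℝ] E)) ∞
    (fun x => TotalSpace.mk' (E →L[ℝ] E)
      (E := fun x : N => TangentSpace I x →L[ℝ] TangentSpace I x) x (J x))) :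
    ContDiffOn ℝ ∞ (chartEndomorphism J p) (extChartAt I p).target := by
  rw [contDiffOn_clm_apply]
  intro v
  exact contDiffOn_comp_extChartAt_symm fun x hx => contMDiffAt_coframe_endomorphism hJ hx v

end ChartTensors

/-! ### The Levi-Civita connection on coordinate fields. -/

section ChartConnection

set_option maxSynthPendingDepth 3

variable {E : Type*} [NormedAddCommGroup E] [NormedSpace ℝ E] [FiniteDimensional ℝ E]
  {H : Type*} [TopologicalSpace H] {I : ModelWithCorners ℝ E H} [I.Boundaryless]
  {N : Type*} [TopologicalSpace N] [ChartedSpace H N] [IsManifold I ∞ N]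
  (g : ContMDiffRiemannianMetric I ∞ E (fun x : N => TangentSpace I x))
  {p x : N}

theorem differentiableAt_chartMetric (hx : x ∈ (chartAt H p).source) :
    DifferentiableAt ℝ (chartMetric g p) (extChartAt I p x) :=
  ((contDiffOn_chartMetric g).contDiffAt ((isOpen_extChartAt_target p).mem_nhds
    (mem_extChartAt_target hx))).differentiableAt (by simp)

theorem mvfderiv_pairing_frame (hx : x ∈ (chartAt H p).source) (u v w : E) :
    mvfderiv I (pairing g (fun z => frame I p z u) (fun z => frame I p z v)) x (frame I p x w) =
      fderiv ℝ (chartMetric g p) (extChartAt I p x) w u v := by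
  have h1 := hasFDerivAt_clm_apply_const (hasFDerivAt_clm_apply_const
    (differentiableAt_chartMetric g hx).hasFDerivAt u) v
  rw [mvfderiv_eq_fderiv hx h1.differentiableAt, h1.fderiv, coframe_frame hx]
  · rfl
  · filter_upwards [eventually_mem_chart_source hx] with z hz
    rw [chartMetric_apply g hz]
    rfl

/-- The Christoffel symbols of `g` in the coordinates of the chart at `p`. -/
abbrev chartChristoffel (p : N) : E → E →L[ℝ] E →L[ℝ] E := localChristoffel (chartMetric g p)

/-- With vanishing brackets, the Koszul expression reduces to the Christoffel symbols of the first
kind. -/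
theorem leviCivita_frame (hx : x ∈ (chartAt H p).source) (u v : E) :
    leviCivita g (fun z => frame I p z v) x (frame I p x u) =
      frame I p x (chartChristoffel g p (extChartAt I p x) u v) := by
  refine eq_of_inner_eq g fun w => ?_
  obtain ⟨w, rfl⟩ : ∃ w', w = frame I p x w' := ⟨_, (frame_coframe hx w).symm⟩
  have h1 := inner_leviCivitaFun g (mdifferentiableAt_frame (I := I) hx u)
    (mdifferentiableAt_frame hx v) (mdifferentiableAt_frame hx w)
  refine h1.trans ?_
  rw [← chartMetric_apply g hx, metric_localChristoffel
    (chartMetric_pos g (mem_extChartAt_target hx)), localKoszul_apply, koszul,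
    mlieBracket_frame hx, mlieBracket_frame hx, mlieBracket_frame hx, mvfderiv_pairing_frame g hx,
    mvfderiv_pairing_frame g hx, mvfderiv_pairing_frame g hx,
    fderiv_metric_symm (isOpen_extChartAt_target p) (contDiffOn_chartMetric g)
      (fun y _ => chartMetric_symm g) (mem_extChartAt_target hx) v w u]
  simp

end ChartConnection

/-! ### Covariant derivatives of general fields and of J in a chart. -/

section ChartCovariantDerivative

set_option maxSynthPendingDepth 3

variable {E : Type*} [NormedAddCommGroup E] [NormedSpace ℝ E] [FiniteDimensional ℝ E]
  {H : Type*} [TopologicalSpace H] {I : ModelWithCorners ℝ E H} [I.Boundaryless]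
  {N : Type*} [TopologicalSpace N] [ChartedSpace H N] [IsManifold I ∞ N]
  (g : ContMDiffRiemannianMetric I ∞ E (fun x : N => TangentSpace I x))
  {J : Π x : N, TangentSpace I x →L[ℝ] TangentSpace I x}
  {p x : N}

omit [FiniteDimensional ℝ E] [I.Boundaryless] [IsManifold I ∞ N] in
theorem mvfderiv_congr {F : Type*} [NormedAddCommGroup F] [NormedSpace ℝ F] {k k' : N → F}
    (h : k =ᶠ[𝓝 x] k') (w : TangentSpace I x) : mvfderiv I k x w = mvfderiv I k' x w := by
  rw [mvfderiv, mvfderiv, h.mfderiv_eq]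
  rfl

omit [FiniteDimensional ℝ E] [I.Boundaryless] in
theorem mdifferentiableAt_coframe (hx : x ∈ (chartAt H p).source)
    {Y : Π x : N, TangentSpace I x} (hY : MDiffAt (T% Y) x) :
    MDifferentiableAt I 𝓘(ℝ, E) (fun z => coframe I p z (Y z)) x := by
  have h1 := ((trivializationAt E (TangentSpace I : N → Type _) p).mdifferentiableAt_section_iff
    I Y (by simpa using hx)).1 hY
  refine h1.congr_of_eventuallyEq ?_
  filter_upwards [eventually_mem_chart_source hx] with z hz
  exact (trivialization_apply_eq_coframe hz _).symm

omit [FiniteDimensional ℝ E] in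
theorem exists_differentiableAt_comp_extChartAt {F : Type*} [NormedAddCommGroup F]
    [NormedSpace ℝ F] (hx : x ∈ (chartAt H p).source) {k : N → F}
    (hk : MDifferentiableAt I 𝓘(ℝ, F) k x) :
    ∃ K : E → F, DifferentiableAt ℝ K (extChartAt I p x) ∧
      ∀ᶠ z in 𝓝 x, k z = K (extChartAt I p z) := by
  have hx' : x ∈ (extChartAt I p).source := by rwa [extChartAt_source]
  refine ⟨k ∘ (extChartAt I p).symm, ?_, ?_⟩
  · have h1 := mdifferentiableWithinAt_extChartAt_symm (I := I) (mem_extChartAt_target hx)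
    rw [I.range_eq_univ, mdifferentiableWithinAt_univ] at h1
    rw [← mdifferentiableAt_iff_differentiableAt]
    refine MDifferentiableAt.comp _ ?_ h1
    rwa [(extChartAt I p).left_inv hx']
  · filter_upwards [eventually_mem_chart_source hx] with z hz
    rw [Function.comp_apply, (extChartAt I p).left_inv (by rwa [extChartAt_source])]

/-- The coordinate formula `∇_u Y = D_u Y + Γ(u, Y)`. -/
theorem leviCivita_eq (hx : x ∈ (chartAt H p).source)
    {Y : Π x : N, TangentSpace I x} (hY : MDiffAt (T% Y) x) (u : E) :
    leviCivita g Y x (frame I p x u) =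
      frame I p x (mvfderiv I (fun z => coframe I p z (Y z)) x (frame I p x u)
        + chartChristoffel g p (extChartAt I p x) u (coframe I p x (Y x))) := by
  have hc := (leviCivita g).isCovariantDerivativeOnUniv
  -- The fields satisfying the formula are closed under sums and contain all function multiples of
  -- frame fields. Near x, Y is such a finite sum, and the connection is local.
  let P : (Π x : N, TangentSpace I x) → Prop := fun Y => MDiffAt (T% Y) x ∧
    leviCivita g Y x (frame I p x u) =
      frame I p x (mvfderiv I (fun z => coframe I p z (Y z)) x (frame I p x u)
        + chartChristoffel g p (extChartAt I p x) u (coframe I p x (Y x)))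
  have hzero : P 0 := by
    refine ⟨mdifferentiableAt_zeroSection .., ?_⟩
    have e : (fun z => coframe I p z ((0 : Π x : N, TangentSpace I x) z)) = fun _ => 0 := by
      funext z
      exact map_zero _
    have e' : coframe I p x ((0 : Π x : N, TangentSpace I x) x) = 0 := map_zero _
    rw [CovariantDerivative.zero, e, e', mvfderiv_const]
    simp
  have hadd : ∀ Y Y', P Y → P Y' → P (Y + Y') := by
    rintro Y Y' ⟨h1, h2⟩ ⟨h1', h2'⟩
    refine ⟨mdifferentiableAt_add_section h1 h1', ?_⟩
    have e : (fun z => coframe I p z ((Y + Y') z)) =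
        (fun z => coframe I p z (Y z)) + (fun z => coframe I p z (Y' z)) := by
      funext z
      exact map_add _ _ _
    have e' : coframe I p x ((Y + Y') x) = coframe I p x (Y x) + coframe I p x (Y' x) :=
      map_add _ _ _
    rw [hc.add h1 h1', e, e', mvfderiv_add (mdifferentiableAt_coframe hx h1)
      (mdifferentiableAt_coframe hx h1'), add_apply, add_apply, h2, h2']
    simp only [map_add]
    abel
  have hsmul : ∀ (c : N → ℝ) (b : E), MDiffAt c x → P (c • fun z => frame I p z b) := by
    intro c b hcd
    have hb := mdifferentiableAt_frame (I := I) hx b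
    refine ⟨hcd.smul_section hb, ?_⟩
    have e : (fun z => coframe I p z ((c • fun z => frame I p z b) z)) =ᶠ[𝓝 x]
        c • (fun _ : N => b) := by
      filter_upwards [eventually_mem_chart_source hx] with z hz
      change coframe I p z (c z • frame I p z b) = c z • b
      rw [map_smul, coframe_frame hz]
    rw [hc.leibniz hb hcd, mvfderiv_congr e, e.eq_of_nhds,
      mvfderiv_smul hcd mdifferentiableAt_const, mvfderiv_const, add_apply]
    have := leviCivita_frame g hx u b
    simp [this]
    abel
  have hsum : ∀ {ι : Type} (s : Finset ι) (c : ι → N → ℝ) (b : ι → E),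
      (∀ i, MDiffAt (c i) x) → P (∑ i ∈ s, c i • fun z => frame I p z (b i)) := by
    intro ι s c b hcd
    induction s using Finset.cons_induction with
    | empty => exact hzero
    | cons i s hi ih =>
      rw [Finset.sum_cons]
      exact hadd _ _ (hsmul _ _ (hcd i)) ih
  let b := Module.finBasis ℝ E
  let c : Fin (Module.finrank ℝ E) → N → ℝ := fun i z =>
    (b.coord i).toContinuousLinearMap (coframe I p z (Y z))
  have hcd : ∀ i, MDiffAt (c i) x := fun i =>
    ((b.coord i).toContinuousLinearMap.differentiableAt.mdifferentiableAt).comp x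
      (mdifferentiableAt_coframe hx hY)
  obtain ⟨h1, h2⟩ := hsum Finset.univ c b hcd
  have hev : ∀ᶠ z in 𝓝 x, Y z = (∑ i, c i • fun z => frame I p z (b i)) z := by
    filter_upwards [eventually_mem_chart_source hx] with z hz
    rw [Finset.sum_apply]
    calc Y z = frame I p z (coframe I p z (Y z)) := (frame_coframe hz _).symm
      _ = frame I p z (∑ i, b.repr (coframe I p z (Y z)) i • b i) := by rw [b.sum_repr]
      _ = _ := by
        rw [map_sum]
        refine Finset.sum_congr rfl fun i _ => ?_
        rw [map_smul]
        rfl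
  have e1 : leviCivita g Y x = leviCivita g (∑ i, c i • fun z => frame I p z (b i)) x :=
    hc.congr_of_eventuallyEq hY h1 Filter.univ_mem hev
  have e2 : (fun z => coframe I p z (Y z)) =ᶠ[𝓝 x]
      fun z => coframe I p z ((∑ i, c i • fun z => frame I p z (b i)) z) :=
    hev.mono fun z hz => congrArg _ hz
  rw [e1, h2, mvfderiv_congr e2, hev.self_of_nhds]

/-- The coordinate formula for `(∇_u J) Y`. -/
theorem covDerivJ_eq (hJ : IsAlmostHermitian g J) (hx : x ∈ (chartAt H p).source)
    {Y : Π x : N, TangentSpace I x} (hY : MDiffAt (T% Y) x) (u : E) :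
    covDerivJ g J Y x (frame I p x u) =
      frame I p x (localCovJ (chartEndomorphism J p) (chartChristoffel g p) (extChartAt I p x) u
        (coframe I p x (Y x))) := by
  have hJY : MDiffAt (T% fun z => J z (Y z)) x :=
    MDifferentiableAt.clm_bundle_apply (F₁ := E) (F₂ := E)
      ((hJ.smooth x).mdifferentiableAt (by simp)) hY
  have hd : DifferentiableAt ℝ (chartEndomorphism J p) (extChartAt I p x) :=
    ((contDiffOn_chartEndomorphism hJ.smooth).contDiffAt ((isOpen_extChartAt_target p).mem_nhds
      (mem_extChartAt_target hx))).differentiableAt (by simp)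
  have hy := mdifferentiableAt_coframe hx hY
  have e1 : ∀ z ∈ (chartAt H p).source, coframe I p z (J z (Y z)) =
      chartEndomorphism J p (extChartAt I p z) (coframe I p z (Y z)) := by
    intro z hz
    rw [chartEndomorphism_apply J hz, frame_coframe hz]
  have e2 : mvfderiv I (fun z => coframe I p z (J z (Y z))) x (frame I p x u) =
      fderiv ℝ (chartEndomorphism J p) (extChartAt I p x) u (coframe I p x (Y x))
        + chartEndomorphism J p (extChartAt I p x)
          (mvfderiv I (fun z => coframe I p z (Y z)) x (frame I p x u)) := by
    obtain ⟨K, hK, hKe⟩ := exists_differentiableAt_comp_extChartAt hx hy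
    have hprod := hd.hasFDerivAt.clm_apply hK.hasFDerivAt
    rw [mvfderiv_eq_fderiv hx hprod.differentiableAt, hprod.fderiv,
      mvfderiv_eq_fderiv hx hK hKe, coframe_frame hx, hKe.self_of_nhds]
    · simp
      abel
    · filter_upwards [eventually_mem_chart_source hx, hKe] with z hz hz'
      rw [e1 z hz, hz']
  have e3 : covDerivJ g J Y x (frame I p x u) =
      leviCivita g (fun z => J z (Y z)) x (frame I p x u)
        - J x (leviCivita g Y x (frame I p x u)) := rfl
  have e4 : ∀ v, J x (frame I p x v) =
      frame I p x (chartEndomorphism J p (extChartAt I p x) v) := by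
    intro v
    rw [chartEndomorphism_apply J hx, frame_coframe hx]
  rw [e3, leviCivita_eq g hx hJY, leviCivita_eq g hx hY, e2, e1 x hx, e4, localCovJ_apply]
  simp only [map_add, map_sub]
  abel

/-- The coordinate expression of a nearly Kähler structure is a local nearly Kähler structure. -/
theorem IsNearlyKahler.isLocalNearlyKahler (hJ : IsNearlyKahler g J) (p : N) :
    IsLocalNearlyKahler (extChartAt I p).target (chartMetric g p) (chartEndomorphism J p)
      (chartChristoffel g p) := by
  have hmem : ∀ y ∈ (extChartAt I p).target, ∃ x ∈ (chartAt H p).source,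
      y = extChartAt I p x := fun y hy =>
    ⟨(extChartAt I p).symm y, by simpa using (extChartAt I p).map_target hy,
      ((extChartAt I p).right_inv hy).symm⟩
  have hG := contDiffOn_chartMetric (p := p) g
  have hU := isOpen_extChartAt_target (I := I) p
  have hs : ∀ y ∈ (extChartAt I p).target, ∀ u v,
      chartMetric g p y u v = chartMetric g p y v u := fun y _ => chartMetric_symm g
  have hp : ∀ y ∈ (extChartAt I p).target, ∀ u, u ≠ 0 → 0 < chartMetric g p y u u :=
    fun y hy => chartMetric_pos g hy
  refine ⟨hU, hG, contDiffOn_chartEndomorphism hJ.smooth, contDiffOn_localChristoffel hU hG hp,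
    hs, hp, fun y hy => localChristoffel_symm hU hG hs hy,
    fun y hy => localChristoffel_metric hU hG hs hp hy, ?_, ?_, ?_⟩
  · intro y hy v
    obtain ⟨x, hx, rfl⟩ := hmem y hy
    rw [chartEndomorphism_apply J hx, chartEndomorphism_apply J hx, frame_coframe hx, hJ.sq,
      map_neg, coframe_frame hx]
  · intro y hy u v
    obtain ⟨x, hx, rfl⟩ := hmem y hy
    rw [chartEndomorphism_apply J hx, chartEndomorphism_apply J hx, chartMetric_apply g hx,
      frame_coframe hx, frame_coframe hx, hJ.isometry, chartMetric_apply g hx]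
  · intro y hy v
    obtain ⟨x, hx, rfl⟩ := hmem y hy
    have h1 := hJ.skew x (fun z => frame I p z v) (mdifferentiableAt_frame hx v)
    rw [covDerivJ_eq g hJ.toIsAlmostHermitian hx (mdifferentiableAt_frame hx v),
      coframe_frame hx] at h1
    rw [← coframe_frame (I := I) hx (localCovJ _ _ _ _ _), h1, map_zero]

end ChartCovariantDerivative

/-! ### The immersion in charts and its Hessian. -/

section ChartMap

set_option maxSynthPendingDepth 3

variable {E' : Type*} [NormedAddCommGroup E'] [NormedSpace ℝ E']
  {H' : Type*} [TopologicalSpace H'] {I' : ModelWithCorners ℝ E' H'} [I'.Boundaryless]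
  {M : Type*} [TopologicalSpace M] [ChartedSpace H' M] [IsManifold I' ∞ M]
  {E : Type*} [NormedAddCommGroup E] [NormedSpace ℝ E] [FiniteDimensional ℝ E]
  {H : Type*} [TopologicalSpace H] {I : ModelWithCorners ℝ E H} [I.Boundaryless]
  {N : Type*} [TopologicalSpace N] [ChartedSpace H N] [IsManifold I ∞ N]
  (g : ContMDiffRiemannianMetric I ∞ E (fun x : N => TangentSpace I x))
  {J : Π x : N, TangentSpace I x →L[ℝ] TangentSpace I x}
  {f : M → N} {p q : M}

variable (I' I f) in
/-- The map `f` in the coordinates of the charts at `p` and `f p`. -/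
def chartMap (p : M) (y : E') : E := extChartAt I (f p) (f ((extChartAt I' p).symm y))

variable (I' H f) in
/-- The set on which the coordinate expression of `f` is meaningful. -/
def chartDomain (p : M) : Set E' :=
  (extChartAt I' p).target ∩ (extChartAt I' p).symm ⁻¹' (f ⁻¹' (chartAt H (f p)).source)

omit [I'.Boundaryless] [IsManifold I' ∞ M] [FiniteDimensional ℝ E]
  [I.Boundaryless] [IsManifold I ∞ N] in
theorem chartMap_extChartAt (hq : q ∈ (chartAt H' p).source) :
    chartMap I' I f p (extChartAt I' p q) = extChartAt I (f p) (f q) := by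
  rw [chartMap, (extChartAt I' p).left_inv (by rwa [extChartAt_source])]

omit [IsManifold I' ∞ M] in
theorem isOpen_chartDomain (hf : Continuous f) : IsOpen (chartDomain I' H f p) :=
  (continuousOn_extChartAt_symm p).isOpen_inter_preimage (isOpen_extChartAt_target p)
    ((chartAt H (f p)).open_source.preimage hf)

omit [IsManifold I' ∞ M] [I'.Boundaryless] in
theorem exists_of_mem_chartDomain {y : E'} (hy : y ∈ chartDomain I' H f p) :
    ∃ q ∈ (chartAt H' p).source, f q ∈ (chartAt H (f p)).source ∧ y = extChartAt I' p q :=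
  ⟨(extChartAt I' p).symm y, by simpa using (extChartAt I' p).map_target hy.1, hy.2,
    ((extChartAt I' p).right_inv hy.1).symm⟩

omit [IsManifold I' ∞ M] [I'.Boundaryless] in
theorem extChartAt_mem_chartDomain (hq : q ∈ (chartAt H' p).source)
    (hfq : f q ∈ (chartAt H (f p)).source) : extChartAt I' p q ∈ chartDomain I' H f p := by
  refine ⟨mem_extChartAt_target hq, ?_⟩
  rw [Set.mem_preimage, (extChartAt I' p).left_inv (by rwa [extChartAt_source])]
  exact hfq

omit [I'.Boundaryless] [FiniteDimensional ℝ E] [I.Boundaryless] in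
theorem contDiffOn_chartMap (hf : ContMDiff I' I ∞ f) :
    ContDiffOn ℝ ∞ (chartMap I' I f p) (chartDomain I' H f p) := by
  rw [← contMDiffOn_iff_contDiffOn]
  refine ContMDiffOn.comp (t := (chartAt H (f p)).source) contMDiffOn_extChartAt
    (hf.comp_contMDiffOn ((contMDiffOn_extChartAt_symm p).mono Set.inter_subset_left)) ?_
  exact fun y hy => hy.2

omit [FiniteDimensional ℝ E] [I.Boundaryless] in
theorem fderiv_chartMap (hf : ContMDiff I' I ∞ f) (hq : q ∈ (chartAt H' p).source)
    (hfq : f q ∈ (chartAt H (f p)).source) (a : E') :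
    fderiv ℝ (chartMap I' I f p) (extChartAt I' p q) a =
      coframe I (f p) (f q) (mfderiv I' I f q (frame I' p q a)) := by
  have hd : DifferentiableAt ℝ (chartMap I' I f p) (extChartAt I' p q) :=
    ((contDiffOn_chartMap hf).contDiffAt ((isOpen_chartDomain hf.continuous).mem_nhds
      (extChartAt_mem_chartDomain hq hfq))).differentiableAt (by simp)
  have h1 : mvfderiv I' (extChartAt I (f p) ∘ f) q (frame I' p q a) =
      fderiv ℝ (chartMap I' I f p) (extChartAt I' p q) (coframe I' p q (frame I' p q a)) :=
    mvfderiv_eq_fderiv hq hd (by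
      filter_upwards [eventually_mem_chart_source hq] with z hz
      rw [chartMap_extChartAt hz]
      rfl) _
  rw [coframe_frame hq] at h1
  rw [← h1, coframe_eq_mfderiv hfq, mvfderiv, mfderiv_comp q (mdifferentiableAt_extChartAt hfq)
    (hf.mdifferentiableAt (by simp))]
  rfl

/-- The extension of w has constant coordinates, so df of it has components Df(y)w near p, and
differentiating them gives D²f. The frozen frame extension at f p contributes the Christoffel term.
-/
theorem derivAlong_eq (hf : ContMDiff I' I ∞ f) (v w : TangentSpace I' p) :
    derivAlong (I' := I') g f (fun q => mfderiv I' I f q (extend E' w q)) p v =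
      frame I (f p) (f p) (localHessian (chartChristoffel g (f p)) (chartMap I' I f p)
        (extChartAt I' p p) (coframe I' p p v) (coframe I' p p w)) := by
  have hp := mem_chart_source H' p
  have hfp := mem_chart_source H (f p)
  have hd : HasFDerivAt (fderiv ℝ (chartMap I' I f p))
      (fderiv ℝ (fderiv ℝ (chartMap I' I f p)) (extChartAt I' p p)) (extChartAt I' p p) :=
    ((((contDiffOn_chartMap hf).contDiffAt ((isOpen_chartDomain hf.continuous).mem_nhds
      (extChartAt_mem_chartDomain hp hfp))).fderiv_right (m := 1)
      (WithTop.coe_le_coe.2 (le_top : (2 : ℕ∞) ≤ ⊤))).differentiableAt (by simp)).hasFDerivAt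
  have hd' := hasFDerivAt_clm_apply_const hd (coframe I' p p w)
  have h1 : mvfderiv I' (fun q => (trivializationAt E (TangentSpace I : N → Type _) (f p)
        ⟨f q, mfderiv I' I f q (extend E' w q)⟩).2) p v =
      fderiv ℝ (fderiv ℝ (chartMap I' I f p)) (extChartAt I' p p) (coframe I' p p v)
        (coframe I' p p w) := by
    rw [mvfderiv_eq_fderiv hp hd'.differentiableAt, hd'.fderiv]
    · rfl
    · filter_upwards [eventually_mem_chart_source hp,
        hf.continuous.continuousAt.eventually (eventually_mem_chart_source hfp)] with z hz hz'
      rw [fderiv_chartMap hf hz hz', trivialization_apply_eq_coframe hz', extend_eq_frame w hz]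
  have h2 : leviCivita g (extend E (mfderiv I' I f p w)) (f p) (mfderiv I' I f p v) =
      frame I (f p) (f p) (chartChristoffel g (f p) (extChartAt I (f p) (f p))
        (coframe I (f p) (f p) (mfderiv I' I f p v))
        (coframe I (f p) (f p) (mfderiv I' I f p w))) := by
    rw [← leviCivita_frame g hfp, frame_coframe hfp]
    refine congrArg (fun l : TangentSpace I (f p) →L[ℝ] TangentSpace I (f p) =>
      l (mfderiv I' I f p v)) ?_
    refine (leviCivita g).isCovariantDerivativeOnUniv.congr_of_eventuallyEq
      (mdifferentiableAt_extend I E _) (mdifferentiableAt_frame hfp _) Filter.univ_mem ?_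
    filter_upwards [eventually_mem_chart_source hfp] with z hz
    rw [extend_eq_frame _ hz]
  rw [derivAlong, add_apply, ContinuousLinearMap.comp_apply, ContinuousLinearMap.comp_apply, h1,
    extend_apply_self, h2]
  rw [localHessian, map_add, chartMap_extChartAt hp, fderiv_chartMap hf hp hfp,
    fderiv_chartMap hf hp hfp, frame_coframe hp, frame_coframe hp]
  rfl

end ChartMap

/-! ### Transfer to manifolds and conclusion. -/

section Lagrangian

set_option maxSynthPendingDepth 3

variable {E' : Type*} [NormedAddCommGroup E'] [NormedSpace ℝ E']
  {H' : Type*} [TopologicalSpace H'] {I' : ModelWithCorners ℝ E' H'} [I'.Boundaryless]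
  {M : Type*} [TopologicalSpace M] [ChartedSpace H' M] [IsManifold I' ∞ M]
  {E : Type*} [NormedAddCommGroup E] [NormedSpace ℝ E] [FiniteDimensional ℝ E]
  {H : Type*} [TopologicalSpace H] {I : ModelWithCorners ℝ E H} [I.Boundaryless]
  {N : Type*} [TopologicalSpace N] [ChartedSpace H N] [IsManifold I ∞ N]
  {g : ContMDiffRiemannianMetric I ∞ E (fun x : N => TangentSpace I x)}
  {J : Π x : N, TangentSpace I x →L[ℝ] TangentSpace I x}
  {f : M → N}

omit [I'.Boundaryless] [IsManifold I' ∞ M] [FiniteDimensional ℝ E] [I.Boundaryless] in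
theorem IsLagrangianImmersion.inner_complex_mfderiv (hf : IsLagrangianImmersion I' g J f) (p : M)
    (a b : TangentSpace I' p) :
    g.inner (f p) (J (f p) (mfderiv I' I f p a)) (mfderiv I' I f p b) = 0 := by
  have h : J (f p) (mfderiv I' I f p a) ∈ normalSpace g (tangentImage I' I f p) := by
    rw [← hf.map_tangent]
    exact Submodule.mem_map_of_mem ⟨a, rfl⟩
  exact h _ ⟨b, rfl⟩

omit [I'.Boundaryless] [IsManifold I' ∞ M] [I.Boundaryless] in
/-- The Gauss formula: a tangent vector along a Lagrangian immersion is the sum of a tangential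
part and its normal part, which is the image under `J` of a tangential vector. -/
theorem IsLagrangianImmersion.exists_normalPart_eq (hf : IsLagrangianImmersion I' g J f) (p : M)
    (u : TangentSpace I (f p)) : ∃ a b : TangentSpace I' p,
      normalPart g (tangentImage I' I f p) u = J (f p) (mfderiv I' I f p b) ∧
      u = mfderiv I' I f p a + normalPart g (tangentImage I' I f p) u := by
  have h1 : normalPart g (tangentImage I' I f p) u ∈ normalSpace g (tangentImage I' I f p) :=
    Submodule.projection_apply_mem _ _
  have h2 : u - normalPart g (tangentImage I' I f p) u ∈ tangentImage I' I f p :=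
    Submodule.sub_projection_mem _ _
  rw [← hf.map_tangent] at h1
  obtain ⟨_, ⟨b, rfl⟩, hb⟩ := h1
  obtain ⟨a, ha⟩ := h2
  exact ⟨a, b, hb.symm, eq_add_of_sub_eq ha.symm⟩

omit [FiniteDimensional ℝ E] [I.Boundaryless] in
theorem IsLagrangianImmersion.isLocalIsotropicMap (hf : IsLagrangianImmersion I' g J f) (p : M) :
    IsLocalIsotropicMap (chartDomain I' H f p) (extChartAt I (f p)).target
      (chartMetric g (f p)) (chartEndomorphism J (f p)) (chartMap I' I f p) where
  isOpen := isOpen_chartDomain hf.smooth.continuous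
  contDiffOn := contDiffOn_chartMap hf.smooth
  mapsTo y hy := by
    obtain ⟨q, hq, hfq, rfl⟩ := exists_of_mem_chartDomain hy
    rw [chartMap_extChartAt hq]
    exact mem_extChartAt_target hfq
  isotropic y hy a b := by
    obtain ⟨q, hq, hfq, rfl⟩ := exists_of_mem_chartDomain hy
    rw [chartMap_extChartAt hq, fderiv_chartMap hf.smooth hq hfq, fderiv_chartMap hf.smooth hq hfq,
      chartEndomorphism_apply J hfq, chartMetric_apply g hfq, frame_coframe hfq, frame_coframe hfq,
      frame_coframe hfq]
    exact hf.inner_complex_mfderiv q _ _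

theorem IsLagrangianImmersion.secondFundamentalForm_eq_zero (hN : IsStrictNearlyKahler g J)
    (hf : IsLagrangianImmersion I' g J f) (hdim : Module.finrank ℝ E' = 3) {p : M} {m : ℝ}
    (hm : ∀ v : TangentSpace I' p,
      g.inner (f p) (secondFundamentalForm I' g f p v v) (secondFundamentalForm I' g f p v v) =
        m * g.inner (f p) (mfderiv I' I f p v) (mfderiv I' I f p v) ^ 2)
    (v w : TangentSpace I' p) : secondFundamentalForm I' g f p v w = 0 := by
  have hp := mem_chart_source H' p
  have hfp := mem_chart_source H (f p)
  have hy := chartMap_extChartAt (I' := I') (I := I) (f := f) hp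
  have hd := fderiv_chartMap hf.smooth hp hfp
  have hG (a b : E') : chartMetric g (f p) (chartMap I' I f p (extChartAt I' p p))
      (fderiv ℝ (chartMap I' I f p) (extChartAt I' p p) a)
      (fderiv ℝ (chartMap I' I f p) (extChartAt I' p p) b) =
      g.inner (f p) (mfderiv I' I f p (frame I' p p a)) (mfderiv I' I f p (frame I' p p b)) := by
    rw [hy, hd, hd, chartMetric_apply g hfp, frame_coframe hfp, frame_coframe hfp]
  have hJ (a : E') : chartEndomorphism J (f p) (chartMap I' I f p (extChartAt I' p p))
      (fderiv ℝ (chartMap I' I f p) (extChartAt I' p p) a) =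
      coframe I (f p) (f p) (J (f p) (mfderiv I' I f p (frame I' p p a))) := by
    rw [hy, hd, chartEndomorphism_apply J hfp, frame_coframe hfp]
  have hne (a : E') (ha : a ≠ 0) : mfderiv I' I f p (frame I' p p a) ≠ 0 := by
    intro h0
    have h1 := hf.injective p (h0.trans (map_zero _).symm)
    apply ha
    rw [← coframe_frame (I := I') hp a, h1, map_zero]
  have : FiniteDimensional ℝ E' := Module.finite_of_finrank_eq_succ hdim
  let B : LinearMap.BilinForm ℝ E' := LinearMap.mk₂ ℝ
    (fun a b => g.inner (f p) (mfderiv I' I f p (frame I' p p a)) (mfderiv I' I f p (frame I' p p b)))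
    (by intros; simp) (by intros; simp) (by intros; simp) (by intros; simp)
  obtain ⟨e, he⟩ := exists_basis_orthonormal hdim B (fun a b => g.symm _ _ _)
    (fun a ha => g.pos _ _ (hne a ha))
  have hspan (u : E) : ∃ a b, u =
      fderiv ℝ (chartMap I' I f p) (extChartAt I' p p) a +
        chartEndomorphism J (f p) (chartMap I' I f p (extChartAt I' p p))
          (fderiv ℝ (chartMap I' I f p) (extChartAt I' p p) b) := by
    obtain ⟨a, b, hb, hab⟩ := hf.exists_normalPart_eq p (frame I (f p) (f p) u)
    refine ⟨coframe I' p p a, coframe I' p p b, ?_⟩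
    rw [hJ, hd, frame_coframe hp, frame_coframe hp, ← hb, ← map_add, ← hab, coframe_frame hfp]
  -- Strictness is stated with a vector field Y, but (∇J)Y is tensorial in Y, so the components of Y
  -- at f p serve as the witness.
  have hstrict : ∃ u, localCovJ (chartEndomorphism J (f p)) (chartChristoffel g (f p))
      (chartMap I' I f p (extChartAt I' p p))
      (fderiv ℝ (chartMap I' I f p) (extChartAt I' p p) (e 0)) u ≠ 0 := by
    obtain ⟨Y, hY, hYne⟩ := hN.strict (f p) _ (hne (e 0) (e.ne_zero 0))
    refine ⟨coframe I (f p) (f p) (Y (f p)), fun h0 => hYne ?_⟩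
    rw [← frame_coframe hfp (mfderiv I' I f p (frame I' p p (e 0))),
      covDerivJ_eq g hN.toIsAlmostHermitian hfp hY, ← hd, ← hy, h0, map_zero]
  -- The local result is applied with n the components of the second fundamental form; the Gauss
  -- decomposition of the Hessian supplies its hypothesis on n.
  have key := (hf.isLocalIsotropicMap p).normal_eq_zero_of_isotropic
    (IsNearlyKahler.isLocalNearlyKahler g hN.toIsNearlyKahler (f p))
    (extChartAt_mem_chartDomain hp hfp) e (fun i j => (hG _ _).trans (he i j)) hspan hstrict
    (fun a b => coframe I (f p) (f p)
      (secondFundamentalForm I' g f p (frame I' p p a) (frame I' p p b)))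
    (fun a b => by
      obtain ⟨c, d, hb, hab⟩ := hf.exists_normalPart_eq p (derivAlong (I' := I') g f
        (fun q => mfderiv I' I f q (extend E' (frame I' p p b) q)) p (frame I' p p a))
      refine ⟨coframe I' p p c, coframe I' p p d, ?_, ?_⟩
      · rw [hJ, frame_coframe hp, secondFundamentalForm, hb]
      · rw [hd, frame_coframe hp, ← map_add, secondFundamentalForm, ← hab,
          derivAlong_eq g hf.smooth, coframe_frame hfp, coframe_frame hp, coframe_frame hp])
    m (fun a => by
      rw [hG, hy, chartMetric_apply g hfp, frame_coframe hfp]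
      exact hm _) (coframe I' p p v) (coframe I' p p w)
  rw [frame_coframe hp, frame_coframe hp] at key
  rw [← frame_coframe hfp (secondFundamentalForm I' g f p v w), key, map_zero]

theorem IsLagrangianImmersion.isIsotropic_iff_isTotallyGeodesic (hN : IsStrictNearlyKahler g J)
    (hf : IsLagrangianImmersion I' g J f) (hdim : Module.finrank ℝ E' = 3) :
    IsIsotropic I' g f ↔ IsTotallyGeodesic I' g f := by
  refine ⟨fun ⟨μ, _, hμ⟩ p v w => hf.secondFundamentalForm_eq_zero hN hdim (hμ p) v w, fun h =>
    ⟨fun _ => 0, fun _ => le_rfl, fun p v => ?_⟩⟩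
  rw [h p v v]
  simp

end Lagrangian

end NearlyKahler

end

theorem theorem1p2
    {N : Type*} [TopologicalSpace N] [T2Space N] [SecondCountableTopology N]
    [ChartedSpace (EuclideanSpace ℝ (Fin 6)) N] [IsManifold (𝓡 6) ∞ N]
    (g : ContMDiffRiemannianMetric (𝓡 6) ∞ (EuclideanSpace ℝ (Fin 6))
      (fun x : N => TangentSpace (𝓡 6) x))
    (J : Π x : N, TangentSpace (𝓡 6) x →L[ℝ] TangentSpace (𝓡 6) x)
    (hN : NearlyKahler.IsStrictNearlyKahler g J)
    {M : Type*} [TopologicalSpace M] [T2Space M] [SecondCountableTopology M]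
    [ChartedSpace (EuclideanSpace ℝ (Fin 3)) M] [IsManifold (𝓡 3) ∞ M]
    (f : M → N) (hf : NearlyKahler.IsLagrangianImmersion (𝓡 3) g J f) :
    NearlyKahler.IsIsotropic (𝓡 3) g f ↔ NearlyKahler.IsTotallyGeodesic (𝓡 3) g f :=
  hf.isIsotropic_iff_isTotallyGeodesic hN finrank_euclideanSpace_fin
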